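/- Identify the unit circle with $\mathbb{R}/\mathbb{Z}$. The Basilica lamination consists of the arcs (hyperbolic lines in the unit disk) joining the pairs of points $\{1/3,2/3\}$ and $\left\{\frac{k-1/6}{2^n},\frac{k+1/6}{2^n}\right\}$, $k\in\mathbb{Z}$, $n\ge 0$, of the circle; these join the pairs of external angles identified in the Julia set (the Basilica) of $z^2-1$. The central gap is the connected component of the complement of these arcs in the disk that contains the center of the disk; it corresponds to the central component $C$ of the Basilica. The arcs of the lamination that border the central gap are called central arcs. An arc diagram is a finite set of arcs obtained from $\{1/3,2/3\}$ and $\{1/6,5/6\}$ by repeatedly choosing one of the intervals $[a,b]$ into which the endpoints of the arcs divide the circle, and adding its primary arc $\left\{a+\frac{b-a}{4},\,b-\frac{b-a}{4}\right\}$. An arc pair diagram is an orientation-preserving isomorphism between the $2$-complexes of two arc diagrams (its domain and its range); it defines the homeomorphism of the circle that maps each interval of the domain linearly to the corresponding interval of the range. The homeomorphisms of the circle so obtained are the dyadic rearrangements of the Basilica, and $T_B$ is the set of all of them. The rigid stabilizer $\mathrm{rist}(C)$ is the set of all elements of $T_B$ that have an arc pair diagram whose domain and range consist solely of central arcs. Let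 $\beta$ and $\gamma$ be the orientation-preserving piecewise-linear homeomorphisms of the circle that map the points $1/6,\,2/3,\,17/24,\,5/6$ to $1/6,\,7/24,\,1/3,\,5/6$, respectively (for $\beta$), and $1/6,\,7/24,\,29/96,\,1/3$ to $1/6,\,19/96,\,5/24,\,1/3$, respectively (for $\gamma$), and that are linear between cyclically consecutive ones of these points. Let $\delta(\theta)=\theta+1/2$. Then $\mathrm{rist}(C)$ is the subgroup generated by $\beta$, $\gamma$ and $\delta$ in the group of homeomorphisms of the circle; in particular, $\beta,\gamma,\delta\in\mathrm{rist}(C)$. -/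

import Mathlib

namespace Basilica

/-! ### Arcs, the lamination, the central gap

The circle is `UnitAddCircle = ℝ / ℤ`; an arc is the unordered pair of its endpoints. -/

/-- The arc drawn in the unit disk, without its endpoints: the hyperbolic line with the two given
ideal endpoints, in the projective (Klein) model, i.e. the open straight chord.  The point `θ` of
`ℝ / ℤ` is placed at `exp (2 * π * I * θ)`. -/
noncomputable def chord : Sym2 UnitAddCircle → Set ℂ :=
  Sym2.lift ⟨fun p q => openSegment ℝ (AddCircle.toCircle p : ℂ) (AddCircle.toCircle q : ℂ),
    fun _ _ => openSegment_symm ℝ _ _⟩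

/-- The arcs (leaves) of the Basilica lamination: the arc `{1/3, 2/3}`, and its iterated preimages
`{(k - 1/6) / 2 ^ n, (k + 1/6) / 2 ^ n}`; they join the pairs of angles whose external rays land
at a common point of the Julia set of `z ^ 2 - 1`. -/
def lamination : Set (Sym2 UnitAddCircle) :=
  {s(((1 / 3 : ℝ) : UnitAddCircle), ((2 / 3 : ℝ) : UnitAddCircle))} ∪
    {e | ∃ (k : ℤ) (n : ℕ), e = s(((((k : ℝ) - 1 / 6) / 2 ^ n : ℝ) : UnitAddCircle),
      ((((k : ℝ) + 1 / 6) / 2 ^ n : ℝ) : UnitAddCircle))}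

/-- The central gap: the component of the complement of the lamination in the disk that contains
the center of the disk. -/
noncomputable def centralGap : Set ℂ :=
  connectedComponentIn (Metric.ball (0 : ℂ) 1 \ ⋃ e ∈ lamination, chord e) 0

/-- A central arc is an arc of the lamination that borders the central gap. -/
def IsCentralArc (e : Sym2 UnitAddCircle) : Prop :=
  e ∈ lamination ∧ chord e ⊆ frontier centralGap

/-! ### Arc diagrams -/

/-- `IsArcDiagram A I`: the set of arcs `A` is an arc diagram, and it cuts the circle into the
intervals `I`, where `(a, b)` stands for the image of `[a, b]` in the circle.  One starts with the
arcs `{1/3, 2/3}` and `{1/6, 5/6}`, and repeatedly attaches to some interval its primary arc,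
which divides the interval with ratios `1 : 2 : 1`. -/
inductive IsArcDiagram : Set (Sym2 UnitAddCircle) → Set (ℝ × ℝ) → Prop
  | base : IsArcDiagram
      {s(((1 / 3 : ℝ) : UnitAddCircle), ((2 / 3 : ℝ) : UnitAddCircle)),
        s(((1 / 6 : ℝ) : UnitAddCircle), ((5 / 6 : ℝ) : UnitAddCircle))}
      {(1 / 6, 1 / 3), (1 / 3, 2 / 3), (2 / 3, 5 / 6), (-(1 / 6), 1 / 6)}
  | attach {A : Set (Sym2 UnitAddCircle)} {I : Set (ℝ × ℝ)} (h : IsArcDiagram A I)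
      (a b : ℝ) (hab : (a, b) ∈ I) : IsArcDiagram
      (insert s(((a + (b - a) / 4 : ℝ) : UnitAddCircle), ((b - (b - a) / 4 : ℝ) : UnitAddCircle)) A)
      ((I \ {(a, b)}) ∪
        {(a, a + (b - a) / 4), (a + (b - a) / 4, b - (b - a) / 4), (b - (b - a) / 4, b)})

/-- An arc diagram, together with the intervals into which it divides the circle. -/
structure ArcDiagram where
  arcs : Set (Sym2 UnitAddCircle)
  intervals : Set (ℝ × ℝ)
  isArcDiagram : IsArcDiagram arcs intervals

/-- The starting point on the circle of an interval of an arc diagram, in counterclockwise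
direction. Every vertex of the diagram is the starting point of exactly one interval. -/
def ArcDiagram.start {D : ArcDiagram} (i : D.intervals) : UnitAddCircle := (i.1.1 : ℝ)

/-- The final point on the circle of an interval of an arc diagram, in counterclockwise
direction. -/
def ArcDiagram.finish {D : ArcDiagram} (i : D.intervals) : UnitAddCircle := (i.1.2 : ℝ)

/-- An arc pair diagram: an orientation-preserving isomorphism between the `2`-complexes of two arc
diagrams.  It is a bijection of the intervals (hence of the vertices, each of which is the starting
point of one interval) that preserves counterclockwise succession along the circle, and for which
two vertices are joined by an arc if and only if their images are. -/
structure ArcPairDiagram where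
  domain : ArcDiagram
  range : ArcDiagram
  toEquiv : domain.intervals ≃ range.intervals
  succ_iff : ∀ i j, ArcDiagram.finish i = ArcDiagram.start j ↔
    ArcDiagram.finish (toEquiv i) = ArcDiagram.start (toEquiv j)
  arc_iff : ∀ i j, s(ArcDiagram.start i, ArcDiagram.start j) ∈ domain.arcs ↔
    s(ArcDiagram.start (toEquiv i), ArcDiagram.start (toEquiv j)) ∈ range.arcs

/-- `f` is the homeomorphism of the circle defined by the arc pair diagram `P`: it sends each
interval of the domain linearly to the corresponding interval of the range. -/
def ArcPairDiagram.Defines (P : ArcPairDiagram) (f : UnitAddCircle ≃ₜ UnitAddCircle) : Prop :=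
  ∀ i : P.domain.intervals, ∀ t ∈ Set.Icc (0 : ℝ) 1,
    f ((i.1.1 + t * (i.1.2 - i.1.1) : ℝ) : UnitAddCircle) =
      (((P.toEquiv i).1.1 + t * ((P.toEquiv i).1.2 - (P.toEquiv i).1.1) : ℝ) : UnitAddCircle)

/-- `T_B`, the set of all dyadic rearrangements of the Basilica. -/
def dyadicRearrangements : Set (UnitAddCircle ≃ₜ UnitAddCircle) :=
  {f | ∃ P : ArcPairDiagram, P.Defines f}

/-- `rist(C)`: the elements of `T_B` that have an arc pair diagram consisting solely of central
arcs. -/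
def rist : Set (UnitAddCircle ≃ₜ UnitAddCircle) :=
  {f | f ∈ dyadicRearrangements ∧ ∃ P : ArcPairDiagram, P.Defines f ∧
    (∀ e ∈ P.domain.arcs, IsCentralArc e) ∧ (∀ e ∈ P.range.arcs, IsCentralArc e)}

/-! ### The generators -/

/-- The map of the circle that acts as `F` on the representatives in `[1/6, 7/6)`. -/
noncomputable def circleMap (F : ℝ → ℝ) : UnitAddCircle → UnitAddCircle :=
  AddCircle.liftIco 1 (1 / 6) fun x => (F x : UnitAddCircle)

theorem continuous_circleMap {F : ℝ → ℝ} (hF : Continuous F) (h0 : F (1 / 6) = 1 / 6)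
    (h1 : F (7 / 6) = 7 / 6) : Continuous (circleMap F) := by
  refine AddCircle.liftIco_continuous ?_ ?_
  · have h2 : (1 / 6 + 1 : ℝ) = 7 / 6 := by norm_num
    rw [h2, h0, h1, ← h2, AddCircle.coe_add_period]
  · exact ((AddCircle.continuous_mk' 1).comp hF).continuousOn

theorem circleMap_circleMap {F G : ℝ → ℝ}
    (hF : ∀ x ∈ Set.Ico (1 / 6 : ℝ) (7 / 6), F x ∈ Set.Ico (1 / 6 : ℝ) (7 / 6))
    (hGF : ∀ x ∈ Set.Ico (1 / 6 : ℝ) (7 / 6), G (F x) = x) (θ : UnitAddCircle) :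
    circleMap G (circleMap F θ) = θ := by
  have h2 : (1 / 6 + 1 : ℝ) = 7 / 6 := by norm_num
  obtain ⟨x, hx, rfl⟩ : ∃ x ∈ Set.Ico (1 / 6 : ℝ) (1 / 6 + 1), (x : UnitAddCircle) = θ := by
    have h3 : θ ∈ ((↑) : ℝ → UnitAddCircle) '' Set.Ico (1 / 6 : ℝ) (1 / 6 + 1) := by
      rw [AddCircle.coe_image_Ico_eq]; trivial
    exact h3
  have hx' : x ∈ Set.Ico (1 / 6 : ℝ) (7 / 6) := by rwa [h2] at hx
  unfold circleMap
  rw [AddCircle.liftIco_coe_apply hx, AddCircle.liftIco_coe_apply (by rw [h2]; exact hF x hx'),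
    hGF x hx']

/-- The homeomorphism of the circle that acts as `F` on `[1/6, 7/6)`, given the inverse `G`. -/
noncomputable def circleHomeo (F G : ℝ → ℝ) (cF : Continuous F) (cG : Continuous G)
    (F0 : F (1 / 6) = 1 / 6) (F1 : F (7 / 6) = 7 / 6)
    (G0 : G (1 / 6) = 1 / 6) (G1 : G (7 / 6) = 7 / 6)
    (hF : ∀ x ∈ Set.Ico (1 / 6 : ℝ) (7 / 6), F x ∈ Set.Ico (1 / 6 : ℝ) (7 / 6))
    (hG : ∀ x ∈ Set.Ico (1 / 6 : ℝ) (7 / 6), G x ∈ Set.Ico (1 / 6 : ℝ) (7 / 6))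
    (hGF : ∀ x ∈ Set.Ico (1 / 6 : ℝ) (7 / 6), G (F x) = x)
    (hFG : ∀ x ∈ Set.Ico (1 / 6 : ℝ) (7 / 6), F (G x) = x) : UnitAddCircle ≃ₜ UnitAddCircle where
  toFun := circleMap F
  invFun := circleMap G
  left_inv := circleMap_circleMap hF hGF
  right_inv := circleMap_circleMap hG hFG
  continuous_toFun := continuous_circleMap cF F0 F1
  continuous_invFun := continuous_circleMap cG G0 G1

/-- `β` on `[1/6, 7/6]`: linear between the breakpoints `1/6, 2/3, 17/24, 5/6, 7/6`, which go to
`1/6, 7/24, 1/3, 5/6, 7/6`. -/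
noncomputable def betaFun (x : ℝ) : ℝ :=
  if x ≤ 2 / 3 then 1 / 6 + (x - 1 / 6) / 4
  else if x ≤ 17 / 24 then 7 / 24 + (x - 2 / 3)
  else if x ≤ 5 / 6 then 1 / 3 + 4 * (x - 17 / 24)
  else x

/-- The inverse of `betaFun` on `[1/6, 7/6]`. -/
noncomputable def betaInv (y : ℝ) : ℝ :=
  if y ≤ 7 / 24 then 1 / 6 + 4 * (y - 1 / 6)
  else if y ≤ 1 / 3 then 2 / 3 + (y - 7 / 24)
  else if y ≤ 5 / 6 then 17 / 24 + (y - 1 / 3) / 4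
  else y

/-- `γ` on `[1/6, 7/6]`: linear between the breakpoints `1/6, 7/24, 29/96, 1/3, 7/6`, which go to
`1/6, 19/96, 5/24, 1/3, 7/6`. -/
noncomputable def gammaFun (x : ℝ) : ℝ :=
  if x ≤ 7 / 24 then 1 / 6 + (x - 1 / 6) / 4
  else if x ≤ 29 / 96 then 19 / 96 + (x - 7 / 24)
  else if x ≤ 1 / 3 then 5 / 24 + 4 * (x - 29 / 96)
  else x

/-- The inverse of `gammaFun` on `[1/6, 7/6]`. -/
noncomputable def gammaInv (y : ℝ) : ℝ :=
  if y ≤ 19 / 96 then 1 / 6 + 4 * (y - 1 / 6)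
  else if y ≤ 5 / 24 then 7 / 24 + (y - 19 / 96)
  else if y ≤ 1 / 3 then 29 / 96 + (y - 5 / 24) / 4
  else y

theorem continuous_piecewise (p q r A B C A' B' C' : ℝ) (hpq : p ≤ q) (hqr : q ≤ r)
    (h1 : A + A' * p = B + B' * p) (h2 : B + B' * q = C + C' * q) (h3 : C + C' * r = r) :
    Continuous fun x : ℝ => if x ≤ p then A + A' * x else if x ≤ q then B + B' * x
      else if x ≤ r then C + C' * x else x := by
  refine Continuous.if_le (by fun_prop) (Continuous.if_le (by fun_prop)
    (Continuous.if_le (by fun_prop) continuous_id continuous_id continuous_const ?_)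
    continuous_id continuous_const ?_) continuous_id continuous_const ?_
  · rintro x rfl; exact h3
  · rintro x rfl; simp only [hqr, if_true]; exact h2
  · rintro x rfl; simp only [hpq, if_true]; exact h1

/-- The dyadic rearrangement `β`. -/
noncomputable def beta : UnitAddCircle ≃ₜ UnitAddCircle :=
  circleHomeo betaFun betaInv
    (by
      convert continuous_piecewise (2 / 3) (17 / 24) (5 / 6) (1 / 8) (-(3 / 8)) (-(5 / 2)) (1 / 4) 1 4
        (by norm_num) (by norm_num) (by norm_num) (by norm_num) (by norm_num) using 2 with x
      unfold betaFun; split_ifs <;> ring)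
    (by
      convert continuous_piecewise (7 / 24) (1 / 3) (5 / 6) (-(1 / 2)) (3 / 8) (5 / 8) 4 1 (1 / 4)
        (by norm_num) (by norm_num) (by norm_num) (by norm_num) (by norm_num) using 2 with x
      unfold betaInv; split_ifs <;> ring)
    (by norm_num [betaFun]) (by norm_num [betaFun]) (by norm_num [betaInv]) (by norm_num [betaInv])
    (by rintro x ⟨h1, h2⟩; unfold betaFun; split_ifs <;> constructor <;> linarith)
    (by rintro x ⟨h1, h2⟩; unfold betaInv; split_ifs <;> constructor <;> linarith)
    (by rintro x ⟨h1, h2⟩; unfold betaFun betaInv; split_ifs <;> linarith)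
    (by rintro x ⟨h1, h2⟩; unfold betaFun betaInv; split_ifs <;> linarith)

/-- The dyadic rearrangement `γ`. -/
noncomputable def gamma : UnitAddCircle ≃ₜ UnitAddCircle :=
  circleHomeo gammaFun gammaInv
    (by
      convert continuous_piecewise (7 / 24) (29 / 96) (1 / 3) (1 / 8) (-(3 / 32)) (-1) (1 / 4) 1 4
        (by norm_num) (by norm_num) (by norm_num) (by norm_num) (by norm_num) using 2 with x
      unfold gammaFun; split_ifs <;> ring)
    (by
      convert continuous_piecewise (19 / 96) (5 / 24) (1 / 3) (-(1 / 2)) (3 / 32) (1 / 4) 4 1 (1 / 4)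
        (by norm_num) (by norm_num) (by norm_num) (by norm_num) (by norm_num) using 2 with x
      unfold gammaInv; split_ifs <;> ring)
    (by norm_num [gammaFun]) (by norm_num [gammaFun]) (by norm_num [gammaInv])
    (by norm_num [gammaInv])
    (by rintro x ⟨h1, h2⟩; unfold gammaFun; split_ifs <;> constructor <;> linarith)
    (by rintro x ⟨h1, h2⟩; unfold gammaInv; split_ifs <;> constructor <;> linarith)
    (by rintro x ⟨h1, h2⟩; unfold gammaFun gammaInv; split_ifs <;> linarith)
    (by rintro x ⟨h1, h2⟩; unfold gammaFun gammaInv; split_ifs <;> linarith)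

/-- The dyadic rearrangement `δ`, i.e. `θ ↦ θ + 1/2`. -/
noncomputable def delta : UnitAddCircle ≃ₜ UnitAddCircle :=
  Homeomorph.addRight ((1 / 2 : ℝ) : UnitAddCircle)

end Basilica

namespace Basilica

/-! The theorem is a form of the fact that Thompson's group $T$ is generated by two tree rotations
and the half turn.

Geometry. The central arcs of the lamination are the arc over $[-1/6,1/6]$ and the primary arcs of
the intervals obtained from $[1/6,5/6]$ by repeatedly passing to the first or last quarter. Each of
their chords lies in the frontier of the gap (`IsCapInterval.isCentralArc`), whereas an arc with
both ends strictly under one of them is cut off from the gap (`IsCapInterval.not_isCentralArc`). An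
arc diagram of central arcs is therefore a binary tree with at least one caret: its carets are the
arcs inside $[1/6,5/6]$, and its leaves are the intervals between arcs (`IsArcDiagram.exists_shape`,
`isArcDiagram_of_shape`). An isomorphism of such diagrams sends leaves to leaves and intervals under
arcs to intervals under arcs, and it respects the cyclic order. So it matches the leaves of two
trees up to a cyclic rotation, and `rist` consists of the maps with `IsTreeMap`
(`isTreeMap_of_mem_rist`, `IsTreeMap.mem_rist`).

Algebra. Tree pairs compose by passing to common refinements, so these maps form a group,
`treeMaps`. The map `beta` performs the rotation $A(BC)\to(AB)C$ at the root and `gamma` performs it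
at the left child of the root; conjugating by `beta` gives this rotation at every vertex of the left
spine. These moves bring any tree to the left comb, so trees with equally many carets are related by
a word in the generators that keeps the order of the leaves (`connected_of_carets_eq`). The half
turn `delta` exchanges the two subtrees of the root, which rotates the list of leaves by the size of
the first subtree. Since that size can be prescribed, every cyclic rotation is reached
(`IsTreeMap.mem_closure`). A homeomorphism is determined by where it sends the pieces
(`eq_of_mapsBlock`), so equality of block data gives equality of maps. -/

/-! ### Subdivision of intervals along binary trees -/

/-- The first quarter of an interval. -/
noncomputable def leftPart (i : ℝ × ℝ) : ℝ × ℝ := (i.1, i.1 + (i.2 - i.1) / 4)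

/-- The middle half of an interval, which lies under its primary arc. -/
noncomputable def midPart (i : ℝ × ℝ) : ℝ × ℝ := (i.1 + (i.2 - i.1) / 4, i.2 - (i.2 - i.1) / 4)

/-- The last quarter of an interval. -/
noncomputable def rightPart (i : ℝ × ℝ) : ℝ × ℝ := (i.2 - (i.2 - i.1) / 4, i.2)

/-- Finite binary trees. -/
inductive Shape
  | leaf : Shape
  | node : Shape → Shape → Shape

open Shape

/-- The number of inner nodes of a binary tree. -/
def Shape.carets : Shape → ℕ
  | leaf => 0
  | node l r => l.carets + r.carets + 1

/-- Subdivide the interval `i` along a tree. Every leaf is listed together with the interval under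
an arc that follows it; the last leaf is followed by `u`. -/
noncomputable def blocks : Shape → ℝ × ℝ → ℝ × ℝ → List ((ℝ × ℝ) × (ℝ × ℝ))
  | leaf, i, u => [(i, u)]
  | node l r, i, u => blocks l (leftPart i) (midPart i) ++ blocks r (rightPart i) u

/-- The subdivision of the whole circle given by a tree: the tree is applied to `[1/6, 5/6]`. -/
noncomputable def circleBlocks (T : Shape) : List ((ℝ × ℝ) × (ℝ × ℝ)) :=
  blocks T (1 / 6, 5 / 6) (-(1 / 6), 1 / 6)

theorem length_blocks (T : Shape) (i u : ℝ × ℝ) : (blocks T i u).length = T.carets + 1 := by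
  induction T generalizing i u with
  | leaf => rfl
  | node l r hl hr => simp [blocks, hl, hr, carets]; omega

/-! ### Maps that are linear on an interval -/

/-- `f` maps the interval `i` linearly onto the interval `j`. -/
def MapsLinearly (f : UnitAddCircle ≃ₜ UnitAddCircle) (i j : ℝ × ℝ) : Prop :=
  ∀ t ∈ Set.Icc (0 : ℝ) 1, f ((i.1 + t * (i.2 - i.1) : ℝ) : UnitAddCircle) =
    ((j.1 + t * (j.2 - j.1) : ℝ) : UnitAddCircle)

/-- `f` maps a pair of intervals linearly onto a pair of intervals. -/
def MapsBlock (f : UnitAddCircle ≃ₜ UnitAddCircle) (b c : (ℝ × ℝ) × (ℝ × ℝ)) : Prop :=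
  MapsLinearly f b.1 c.1 ∧ MapsLinearly f b.2 c.2

theorem MapsLinearly.start {f : UnitAddCircle ≃ₜ UnitAddCircle} {i j : ℝ × ℝ}
    (h : MapsLinearly f i j) : f (i.1 : UnitAddCircle) = (j.1 : UnitAddCircle) := by
  simpa using h 0 (by simp)

theorem MapsLinearly.finish {f : UnitAddCircle ≃ₜ UnitAddCircle} {i j : ℝ × ℝ}
    (h : MapsLinearly f i j) : f (i.2 : UnitAddCircle) = (j.2 : UnitAddCircle) := by
  simpa using h 1 (by simp)

theorem MapsLinearly.sub {f : UnitAddCircle ≃ₜ UnitAddCircle} {i j i' j' : ℝ × ℝ} {p q : ℝ}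
    (h : MapsLinearly f i j) (hp : 0 ≤ p) (hpq : p ≤ q) (hq : q ≤ 1)
    (h1 : i'.1 = i.1 + p * (i.2 - i.1)) (h2 : i'.2 = i.1 + q * (i.2 - i.1))
    (h3 : j'.1 = j.1 + p * (j.2 - j.1)) (h4 : j'.2 = j.1 + q * (j.2 - j.1)) :
    MapsLinearly f i' j' := by
  rintro t ⟨ht0, ht1⟩
  have := h (p + t * (q - p)) ⟨by nlinarith, by nlinarith⟩
  rw [show i'.1 + t * (i'.2 - i'.1) = i.1 + (p + t * (q - p)) * (i.2 - i.1) by rw [h1, h2]; ring,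
    show j'.1 + t * (j'.2 - j'.1) = j.1 + (p + t * (q - p)) * (j.2 - j.1) by rw [h3, h4]; ring]
  exact this

theorem MapsLinearly.leftPart {f : UnitAddCircle ≃ₜ UnitAddCircle} {i j : ℝ × ℝ}
    (h : MapsLinearly f i j) : MapsLinearly f (leftPart i) (leftPart j) :=
  h.sub (p := 0) (q := 1 / 4) (by norm_num) (by norm_num) (by norm_num)
    (by simp [Basilica.leftPart]) (by simp [Basilica.leftPart]; ring)
    (by simp [Basilica.leftPart]) (by simp [Basilica.leftPart]; ring)

theorem MapsLinearly.midPart {f : UnitAddCircle ≃ₜ UnitAddCircle} {i j : ℝ × ℝ}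
    (h : MapsLinearly f i j) : MapsLinearly f (midPart i) (midPart j) :=
  h.sub (p := 1 / 4) (q := 3 / 4) (by norm_num) (by norm_num) (by norm_num)
    (by simp [Basilica.midPart]; ring) (by simp [Basilica.midPart]; ring)
    (by simp [Basilica.midPart]; ring) (by simp [Basilica.midPart]; ring)

theorem MapsLinearly.rightPart {f : UnitAddCircle ≃ₜ UnitAddCircle} {i j : ℝ × ℝ}
    (h : MapsLinearly f i j) : MapsLinearly f (rightPart i) (rightPart j) :=
  h.sub (p := 3 / 4) (q := 1) (by norm_num) (by norm_num) (by norm_num)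
    (by simp [Basilica.rightPart]; ring) (by simp [Basilica.rightPart])
    (by simp [Basilica.rightPart]; ring) (by simp [Basilica.rightPart])

theorem MapsLinearly.refl (i : ℝ × ℝ) : MapsLinearly 1 i i := fun _ _ => rfl

theorem MapsLinearly.symm {f : UnitAddCircle ≃ₜ UnitAddCircle} {i j : ℝ × ℝ}
    (h : MapsLinearly f i j) : MapsLinearly f⁻¹ j i := fun t ht => by
  rw [← h t ht]; exact f.symm_apply_apply _

theorem MapsLinearly.trans {f g : UnitAddCircle ≃ₜ UnitAddCircle} {i j k : ℝ × ℝ}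
    (h : MapsLinearly f i j) (h' : MapsLinearly g j k) : MapsLinearly (g * f) i k := fun t ht => by
  rw [← h' t ht, ← h t ht]; rfl

/-- Linear maps respect subdivision in the fixed ratios $1:2:1$, so the same tree may be grafted
onto source and target. -/
theorem MapsBlock.blocks {f : UnitAddCircle ≃ₜ UnitAddCircle} {i u j v : ℝ × ℝ}
    (h : MapsLinearly f i j) (h' : MapsLinearly f u v) (T : Shape) :
    List.Forall₂ (MapsBlock f) (blocks T i u) (blocks T j v) := by
  induction T generalizing i u j v with
  | leaf => exact .cons ⟨h, h'⟩ .nil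
  | node l r hl hr =>
    exact List.rel_append (hl h.leftPart h.midPart) (hr h.rightPart h')

theorem forall₂_mapsBlock_refl (l : List ((ℝ × ℝ) × (ℝ × ℝ))) :
    List.Forall₂ (MapsBlock 1) l l :=
  List.forall₂_same.2 fun _ _ => ⟨.refl _, .refl _⟩

theorem forall₂_mapsBlock_symm {f : UnitAddCircle ≃ₜ UnitAddCircle}
    {l m : List ((ℝ × ℝ) × (ℝ × ℝ))} (h : List.Forall₂ (MapsBlock f) l m) :
    List.Forall₂ (MapsBlock f⁻¹) m l :=
  h.flip.imp fun _ _ h => ⟨h.1.symm, h.2.symm⟩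

theorem forall₂_mapsBlock_trans {f g : UnitAddCircle ≃ₜ UnitAddCircle}
    {l m n : List ((ℝ × ℝ) × (ℝ × ℝ))} (h : List.Forall₂ (MapsBlock f) l m)
    (h' : List.Forall₂ (MapsBlock g) m n) : List.Forall₂ (MapsBlock (g * f)) l n := by
  induction h generalizing n with
  | nil => cases h'; exact .nil
  | cons h _ ih =>
    cases h' with
    | cons k k' => exact .cons ⟨h.1.trans k.1, h.2.trans k.2⟩ (ih k')

/-! ### The generators act by rotating trees -/

theorem mapsLinearly_of_lift {f : UnitAddCircle ≃ₜ UnitAddCircle} {F : ℝ → ℝ} {i j : ℝ × ℝ}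
    (hf : ∀ x : ℝ, 1 / 6 ≤ x → x < 7 / 6 → f (x : UnitAddCircle) = (F x : UnitAddCircle))
    (hi0 : 1 / 6 ≤ i.1) (hi : i.1 ≤ i.2) (hi1 : i.2 < 7 / 6)
    (h : ∀ t : ℝ, 0 ≤ t → t ≤ 1 → F (i.1 + t * (i.2 - i.1)) = j.1 + t * (j.2 - j.1)) :
    MapsLinearly f i j := by
  rintro t ⟨h0, h1⟩
  rw [hf _ (by nlinarith) (by nlinarith), h t h0 h1]

theorem circleMap_coe (F : ℝ → ℝ) (x : ℝ) (h1 : 1 / 6 ≤ x) (h2 : x < 7 / 6) :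
    circleMap F (x : UnitAddCircle) = (F x : UnitAddCircle) := by
  unfold circleMap
  rw [AddCircle.liftIco_coe_apply ⟨h1, by linarith⟩]

theorem beta_coe (x : ℝ) (h1 : 1 / 6 ≤ x) (h2 : x < 7 / 6) :
    beta (x : UnitAddCircle) = (betaFun x : UnitAddCircle) := circleMap_coe _ x h1 h2

theorem gamma_coe (x : ℝ) (h1 : 1 / 6 ≤ x) (h2 : x < 7 / 6) :
    gamma (x : UnitAddCircle) = (gammaFun x : UnitAddCircle) := circleMap_coe _ x h1 h2

theorem mapsLinearly_of_fix {f : UnitAddCircle ≃ₜ UnitAddCircle}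
    (hf : ∀ x : ℝ, 5 / 6 ≤ x → x < 7 / 6 → f (x : UnitAddCircle) = (x : UnitAddCircle))
    (h6 : f ((1 / 6 : ℝ) : UnitAddCircle) = ((1 / 6 : ℝ) : UnitAddCircle)) :
    MapsLinearly f (-(1 / 6), 1 / 6) (-(1 / 6), 1 / 6) := by
  rintro t ⟨h0, h1⟩
  rcases h1.lt_or_eq with h1 | rfl
  · have := hf (-(1 / 6) + t * (1 / 6 - -(1 / 6)) + 1) (by linarith) (by linarith)
    rwa [AddCircle.coe_add_period] at this
  · norm_num at h6 ⊢; exact h6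

theorem beta_mapsLinearly_cap :
    MapsLinearly beta (-(1 / 6), 1 / 6) (-(1 / 6), 1 / 6) := by
  refine mapsLinearly_of_fix (fun x h1 h2 => ?_) ?_
  · rw [beta_coe x (by linarith) h2]
    congr 1
    unfold betaFun; split_ifs <;> linarith
  · rw [beta_coe _ (by norm_num) (by norm_num)]
    congr 1
    norm_num [betaFun]

theorem gamma_mapsLinearly_cap :
    MapsLinearly gamma (-(1 / 6), 1 / 6) (-(1 / 6), 1 / 6) := by
  refine mapsLinearly_of_fix (fun x h1 h2 => ?_) ?_
  · rw [gamma_coe x (by linarith) h2]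
    congr 1
    unfold gammaFun; split_ifs <;> linarith
  · rw [gamma_coe _ (by norm_num) (by norm_num)]
    congr 1
    norm_num [gammaFun]

/-- The breakpoints of `beta` are endpoints of pieces of the tree with three leaves, so `beta` is
linear on each piece and carries along whatever `A`, `B`, `C` are grafted there. -/
theorem beta_rotate (A B C : Shape) :
    List.Forall₂ (MapsBlock beta) (circleBlocks (node A (node B C)))
      (circleBlocks (node (node A B) C)) := by
  simp only [circleBlocks, blocks, List.append_assoc]
  refine List.rel_append (MapsBlock.blocks ?_ ?_ A) (List.rel_append (MapsBlock.blocks ?_ ?_ B)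
    (MapsBlock.blocks ?_ beta_mapsLinearly_cap C)) <;>
  · refine mapsLinearly_of_lift beta_coe ?_ ?_ ?_ ?_ <;>
      norm_num [leftPart, midPart, rightPart]
    intro t h0 h1
    unfold betaFun
    split_ifs <;> linarith

theorem gamma_rotate (A B C D : Shape) :
    List.Forall₂ (MapsBlock gamma) (circleBlocks (node (node A (node B C)) D))
      (circleBlocks (node (node (node A B) C) D)) := by
  simp only [circleBlocks, blocks, List.append_assoc]
  refine List.rel_append (MapsBlock.blocks ?_ ?_ A) (List.rel_append (MapsBlock.blocks ?_ ?_ B)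
    (List.rel_append (MapsBlock.blocks ?_ ?_ C) (MapsBlock.blocks ?_ gamma_mapsLinearly_cap D))) <;>
  · refine mapsLinearly_of_lift gamma_coe ?_ ?_ ?_ ?_ <;>
      norm_num [leftPart, midPart, rightPart]
    intro t h0 h1
    unfold gammaFun
    split_ifs <;> linarith

theorem coe_eq_coe_iff (x y : ℝ) :
    (x : UnitAddCircle) = (y : UnitAddCircle) ↔ ∃ n : ℤ, y = x + n := by
  rw [eq_comm, ← sub_eq_zero, ← AddCircle.coe_sub, AddCircle.coe_eq_zero_iff]
  simp only [zsmul_eq_mul, mul_one]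
  exact exists_congr fun n => ⟨fun h => by linarith, fun h => by linarith⟩

theorem delta_mapsLinearly {i j : ℝ × ℝ} (n : ℤ) (h1 : j.1 = i.1 + 1 / 2 + n)
    (h2 : j.2 = i.2 + 1 / 2 + n) : MapsLinearly delta i j := by
  intro t _
  change ((_ : ℝ) : UnitAddCircle) + ((1 / 2 : ℝ) : UnitAddCircle) = _
  rw [← AddCircle.coe_add, coe_eq_coe_iff]
  exact ⟨n, by rw [h1, h2]; ring⟩

theorem delta_swap (A B : Shape) :
    ∃ l, List.Forall₂ (MapsBlock delta) (circleBlocks (node A B)) l ∧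
      circleBlocks (node B A) = l.rotate (A.carets + 1) := by
  -- The half turn exchanges the two quarters $[1/6,1/3]$ and $[2/3,5/6]$, and also the arcs over
  -- $[1/3,2/3]$ and $[-1/6,1/6]$. The integers $0$ and $-1$ restore the chosen real
  -- representatives.
  refine ⟨blocks A (2 / 3, 5 / 6) (-(1 / 6), 1 / 6) ++ blocks B (1 / 6, 1 / 3) (1 / 3, 2 / 3),
    List.rel_append (MapsBlock.blocks (delta_mapsLinearly 0 ?_ ?_) (delta_mapsLinearly (-1) ?_ ?_) A)
      (MapsBlock.blocks (delta_mapsLinearly (-1) ?_ ?_) (delta_mapsLinearly 0 ?_ ?_) B), ?_⟩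
  any_goals norm_num [leftPart, midPart, rightPart]
  rw [← length_blocks A (2 / 3, 5 / 6) (-(1 / 6), 1 / 6), List.rotate_append_length_eq]
  simp only [circleBlocks, blocks]
  norm_num [leftPart, midPart, rightPart]

/-! ### Refinement of subdivisions -/

/-- Subdivide every leaf in a list of blocks along a tree. -/
noncomputable def refineBlocks (ts : List Shape) (l : List ((ℝ × ℝ) × (ℝ × ℝ))) :
    List ((ℝ × ℝ) × (ℝ × ℝ)) :=
  (List.zipWith (fun t b => blocks t b.1 b.2) ts l).flatten

theorem refineBlocks_append {ts ts' : List Shape} {l l' : List ((ℝ × ℝ) × (ℝ × ℝ))}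
    (h : ts.length = l.length) :
    refineBlocks (ts ++ ts') (l ++ l') = refineBlocks ts l ++ refineBlocks ts' l' := by
  simp [refineBlocks, List.zipWith_append h]

/-- Moving one leaf to the end before refining moves a whole group of leaves after refining, so the
amount of rotation changes and only the cyclic order survives. -/
theorem refineBlocks_rotate (n : ℕ) {ts : List Shape} {l : List ((ℝ × ℝ) × (ℝ × ℝ))}
    (h : ts.length = l.length) :
    refineBlocks (ts.rotate n) (l.rotate n) ~r refineBlocks ts l := by
  induction n generalizing ts l with
  | zero => simpa using List.IsRotated.refl _
  | succ n ih =>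
    match ts, l, h with
    | [], [], _ => simpa using List.IsRotated.refl _
    | t :: ts, b :: l, h =>
      have h' : ts.length = l.length := by simpa using h
      rw [List.rotate_cons_succ, List.rotate_cons_succ]
      refine (ih (by simp [h'])).trans ?_
      rw [refineBlocks_append h']
      have : refineBlocks (t :: ts) (b :: l) = refineBlocks [t] [b] ++ refineBlocks ts l := by
        simp [refineBlocks]
      rw [this]
      exact List.isRotated_append

theorem forall₂_refineBlocks {f : UnitAddCircle ≃ₜ UnitAddCircle}
    {l m : List ((ℝ × ℝ) × (ℝ × ℝ))} (h : List.Forall₂ (MapsBlock f) l m) (ts : List Shape) :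
    List.Forall₂ (MapsBlock f) (refineBlocks ts l) (refineBlocks ts m) := by
  induction h generalizing ts with
  | nil => simp [refineBlocks]
  | cons h _ ih =>
    cases ts with
    | nil => simp [refineBlocks]
    | cons t ts =>
      simpa [refineBlocks] using List.rel_append (MapsBlock.blocks h.1 h.2 t) (ih ts)

theorem forall₂_rotate {α β : Type*} {R : α → β → Prop} {l : List α} {m : List β}
    (h : List.Forall₂ R l m) (n : ℕ) : List.Forall₂ R (l.rotate n) (m.rotate n) := by
  induction n generalizing l m with
  | zero => simpa using h
  | succ n ih =>
    cases h with
    | nil => simp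
    | cons h h' =>
      rw [List.rotate_cons_succ, List.rotate_cons_succ]
      exact ih (List.rel_append h' (.cons h .nil))

theorem exists_graft (S : Shape) (ts : List Shape) (h : ts.length = S.carets + 1) :
    ∃ S' : Shape, S.carets ≤ S'.carets ∧
      ∀ i u, blocks S' i u = refineBlocks ts (blocks S i u) := by
  induction S generalizing ts with
  | leaf =>
    match ts, h with
    | [t], _ => exact ⟨t, by simp [carets], fun i u => by simp [refineBlocks, blocks]⟩
  | node l r hl hr =>
    rw [carets] at h
    obtain ⟨l', hl1, hl2⟩ := hl (ts.take (l.carets + 1)) (by rw [List.length_take]; omega)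
    obtain ⟨r', hr1, hr2⟩ := hr (ts.drop (l.carets + 1)) (by rw [List.length_drop]; omega)
    refine ⟨node l' r', by simp only [carets]; omega, fun i u => ?_⟩
    rw [blocks, hl2, hr2, blocks, ← refineBlocks_append, List.take_append_drop]
    rw [List.length_take, length_blocks]; omega

/-- The common refinement of two trees. -/
def Shape.join : Shape → Shape → Shape
  | leaf, T => T
  | node l r, leaf => node l r
  | node l r, node l' r' => node (join l l') (join r r')

theorem Shape.join_comm (S T : Shape) : S.join T = T.join S := by
  induction S generalizing T with
  | leaf => cases T <;> rfl
  | node l r hl hr => cases T <;> simp [join, hl, hr]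

theorem exists_refineBlocks_join (S T : Shape) :
    ∃ ts : List Shape, ts.length = S.carets + 1 ∧
      ∀ i u, blocks (S.join T) i u = refineBlocks ts (blocks S i u) := by
  -- Every tree refines itself trivially, with a single leaf grafted at each leaf.
  have key : ∀ S : Shape, ∃ ts : List Shape, ts.length = S.carets + 1 ∧
      ∀ i u, blocks S i u = refineBlocks ts (blocks S i u) := by
    intro S
    induction S with
    | leaf => exact ⟨[leaf], by simp [carets], fun i u => by simp [refineBlocks, blocks]⟩
    | node l r hl hr =>
      obtain ⟨ts, h1, h2⟩ := hl
      obtain ⟨ts', h1', h2'⟩ := hr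
      refine ⟨ts ++ ts', by simp [carets, h1, h1']; omega, fun i u => ?_⟩
      rw [blocks, refineBlocks_append (by rw [h1, length_blocks]), ← h2, ← h2']
  induction S generalizing T with
  | leaf => exact ⟨[T], by simp [carets], fun i u => by simp [refineBlocks, blocks, join]⟩
  | node l r hl hr =>
    cases T with
    | leaf => exact key _
    | node l' r' =>
      obtain ⟨ts, h1, h2⟩ := hl l'
      obtain ⟨ts', h1', h2'⟩ := hr r'
      refine ⟨ts ++ ts', by simp [carets, h1, h1']; omega, fun i u => ?_⟩
      rw [join, blocks, blocks, refineBlocks_append (by rw [h1, length_blocks]), ← h2, ← h2']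

/-! ### Homeomorphisms given by pairs of trees -/

/-- `f` maps the blocks of a nontrivial tree to the blocks of another tree, up to a rotation. -/
def IsTreeMap (f : UnitAddCircle ≃ₜ UnitAddCircle) : Prop :=
  ∃ (S T : Shape) (l : List ((ℝ × ℝ) × (ℝ × ℝ))), S.carets ≠ 0 ∧ l ~r circleBlocks T ∧
    List.Forall₂ (MapsBlock f) (circleBlocks S) l

theorem length_circleBlocks (T : Shape) : (circleBlocks T).length = T.carets + 1 :=
  length_blocks ..

theorem carets_eq {f : UnitAddCircle ≃ₜ UnitAddCircle} {S T : Shape}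
    {l : List ((ℝ × ℝ) × (ℝ × ℝ))} (hl : l ~r circleBlocks T)
    (h : List.Forall₂ (MapsBlock f) (circleBlocks S) l) : S.carets = T.carets := by
  have := h.length_eq
  rw [hl.perm.length_eq, length_circleBlocks, length_circleBlocks] at this
  omega

/-- The leaves of `S` and `T` correspond up to a rotation, so the trees that enlarge `T` to the join
can be grafted onto the corresponding leaves of `S`. -/
theorem exists_refinement {f : UnitAddCircle ≃ₜ UnitAddCircle} {S T : Shape}
    {l : List ((ℝ × ℝ) × (ℝ × ℝ))} (hl : l ~r circleBlocks T)
    (h : List.Forall₂ (MapsBlock f) (circleBlocks S) l) (W : Shape) :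
    ∃ S' l', S.carets ≤ S'.carets ∧ l' ~r circleBlocks (T.join W) ∧
      List.Forall₂ (MapsBlock f) (circleBlocks S') l' := by
  obtain ⟨ts, h1, h2⟩ := exists_refineBlocks_join T W
  obtain ⟨n, rfl⟩ := hl.symm
  obtain ⟨S', hS, hS'⟩ := exists_graft S (ts.rotate n)
    (by rw [List.length_rotate, h1, carets_eq hl h])
  refine ⟨S', refineBlocks (ts.rotate n) ((circleBlocks T).rotate n), hS, ?_, ?_⟩
  · rw [circleBlocks, circleBlocks, h2]
    exact refineBlocks_rotate n (by rw [h1, length_blocks])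
  · rw [circleBlocks, hS']
    exact forall₂_refineBlocks h _

theorem exists_inverse {f : UnitAddCircle ≃ₜ UnitAddCircle} {S T : Shape}
    {l : List ((ℝ × ℝ) × (ℝ × ℝ))} (hl : l ~r circleBlocks T)
    (h : List.Forall₂ (MapsBlock f) (circleBlocks S) l) :
    ∃ m, m ~r circleBlocks S ∧ List.Forall₂ (MapsBlock f⁻¹) (circleBlocks T) m := by
  obtain ⟨n, hn⟩ := hl
  refine ⟨(circleBlocks S).rotate n, .symm ⟨n, rfl⟩, ?_⟩
  rw [← hn]
  exact forall₂_rotate (forall₂_mapsBlock_symm h) n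

theorem IsTreeMap.inv {f : UnitAddCircle ≃ₜ UnitAddCircle} (h : IsTreeMap f) : IsTreeMap f⁻¹ := by
  obtain ⟨S, T, l, hS, hl, h⟩ := h
  obtain ⟨m, hm, h'⟩ := exists_inverse hl h
  exact ⟨T, S, m, carets_eq hl h ▸ hS, hm, h'⟩

theorem IsTreeMap.mul {f g : UnitAddCircle ≃ₜ UnitAddCircle} (hg : IsTreeMap g)
    (hf : IsTreeMap f) : IsTreeMap (g * f) := by
  obtain ⟨S, T, l, hS, hl, h⟩ := hf
  obtain ⟨S', T', l', -, hl', h'⟩ := hg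
  obtain ⟨m', hm', h''⟩ := exists_inverse hl' h'
  obtain ⟨S₁, l₁, hS₁, hl₁, h₁⟩ := exists_refinement hl h S'
  -- Only targets can be refined, so the source of `g` is refined as the target of its inverse. Both
  -- refinements then meet in the join of `T` and `S'`.
  obtain ⟨S₂, l₂, -, hl₂, h₂⟩ := exists_refinement hm' h'' T
  rw [join_comm] at hl₂
  obtain ⟨n, rfl⟩ := hl₂.trans hl₁.symm
  have h₃ := forall₂_rotate (forall₂_mapsBlock_symm h₂) n
  rw [inv_inv] at h₃
  exact ⟨S₁, S₂, (circleBlocks S₂).rotate n, by omega, .symm ⟨n, rfl⟩,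
    forall₂_mapsBlock_trans h₁ h₃⟩

theorem isTreeMap_one : IsTreeMap 1 :=
  ⟨node leaf leaf, _, _, by simp [carets], .refl _, forall₂_mapsBlock_refl _⟩

theorem isTreeMap_beta : IsTreeMap beta :=
  ⟨_, _, _, by simp [carets], .refl _, beta_rotate leaf leaf leaf⟩

theorem isTreeMap_gamma : IsTreeMap gamma :=
  ⟨_, _, _, by simp [carets], .refl _, gamma_rotate leaf leaf leaf leaf⟩

theorem isTreeMap_delta : IsTreeMap delta := by
  obtain ⟨l, h, h'⟩ := delta_swap leaf leaf
  exact ⟨node leaf leaf, _, l, by simp [carets], ⟨_, h'.symm⟩, h⟩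

/-- The homeomorphisms given by pairs of trees form a group. -/
def treeMaps : Subgroup (UnitAddCircle ≃ₜ UnitAddCircle) where
  carrier := {f | IsTreeMap f}
  mul_mem' := IsTreeMap.mul
  one_mem' := isTreeMap_one
  inv_mem' := IsTreeMap.inv

/-! ### The generators generate -/

/-- Some product of the generators maps the blocks of `S` to the blocks of `T` in order. -/
def Connected (S T : Shape) : Prop :=
  ∃ g ∈ Subgroup.closure {beta, gamma, delta},
    List.Forall₂ (MapsBlock g) (circleBlocks S) (circleBlocks T)

theorem Connected.refl (S : Shape) : Connected S S := ⟨1, one_mem _, forall₂_mapsBlock_refl _⟩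

theorem Connected.symm {S T : Shape} (h : Connected S T) : Connected T S := by
  obtain ⟨g, hg, h⟩ := h
  exact ⟨g⁻¹, inv_mem hg, forall₂_mapsBlock_symm h⟩

theorem Connected.trans {S T U : Shape} (h : Connected S T) (h' : Connected T U) :
    Connected S U := by
  obtain ⟨g, hg, h⟩ := h
  obtain ⟨g', hg', h'⟩ := h'
  exact ⟨g' * g, mul_mem hg' hg, forall₂_mapsBlock_trans h h'⟩

theorem connected_rotate (A B C : Shape) :
    Connected (node A (node B C)) (node (node A B) C) :=
  ⟨beta, Subgroup.subset_closure (by simp), beta_rotate A B C⟩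

theorem connected_rotate_left (A B C D : Shape) :
    Connected (node (node A (node B C)) D) (node (node (node A B) C) D) :=
  ⟨gamma, Subgroup.subset_closure (by simp), gamma_rotate A B C D⟩

/-! ### Rotating every tree into the left comb. -/

/-- The tree with right branches `Ds` along its left spine, and `A` at the bottom of the spine. -/
def Shape.spine (A : Shape) : List Shape → Shape
  | [] => A
  | D :: Ds => node (spine A Ds) D

/-- Depths $0$ and $1$ on the left spine are `beta` and `gamma`. At greater depth, a rotation at the
root merges the top two branches into one, which lowers the depth by one, and the inverse rotation
undoes this afterwards. -/
theorem connected_spine_rotate (A B C : Shape) : ∀ Ds : List Shape,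
    Connected (spine (node A (node B C)) Ds) (spine (node (node A B) C) Ds)
  | [] => connected_rotate A B C
  | [D] => connected_rotate_left A B C D
  | D :: E :: Ds =>
    ((connected_rotate _ E D).symm.trans (connected_spine_rotate A B C (node E D :: Ds))).trans
      (connected_rotate _ E D)
termination_by Ds => Ds.length

/-- Attach `k` leaves to the right of a tree, one after the other. -/
def Shape.addLeaves (A : Shape) : ℕ → Shape
  | 0 => A
  | k + 1 => node (addLeaves A k) leaf

theorem Shape.addLeaves_add (A : Shape) (j k : ℕ) :
    A.addLeaves (j + k) = (A.addLeaves j).addLeaves k := by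
  induction k with
  | zero => rfl
  | succ k ih => simp [addLeaves, ih]

theorem Shape.spine_addLeaves (A : Shape) (k : ℕ) (Ds : List Shape) :
    spine (A.addLeaves k) Ds = spine A (Ds ++ List.replicate k leaf) := by
  induction Ds with
  | nil =>
    induction k with
    | zero => rfl
    | succ k ih => simp only [spine, List.nil_append] at ih ⊢
                   rw [addLeaves, ih, List.replicate_succ, spine]
  | cons D Ds ih => simp [spine, ih]

/-- After rotating $A(BC)$ to $(AB)C$, first `C` and then `B` is unrolled into leaves. The branches
`Ds` are arbitrary because the leaves coming from `C` join the spine above `B`. -/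
theorem connected_addLeaves (X A : Shape) (Ds : List Shape) :
    Connected (spine (node A X) Ds) (spine (A.addLeaves (X.carets + 1)) Ds) := by
  induction X generalizing A Ds with
  | leaf => exact .refl _
  | node B C hB hC =>
    refine (connected_spine_rotate A B C Ds).trans ((hC _ Ds).trans ?_)
    rw [spine_addLeaves]
    refine (hB A _).trans ?_
    rw [← spine_addLeaves, ← addLeaves_add, carets]
    rw [show B.carets + 1 + (C.carets + 1) = B.carets + C.carets + 1 + 1 by ring]
    exact .refl _

theorem connected_comb (T : Shape) (Ds : List Shape) :
    Connected (spine T Ds) (spine (leaf.addLeaves T.carets) Ds) := by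
  induction T generalizing Ds with
  | leaf => exact .refl _
  | node A X hA _ =>
    refine (connected_addLeaves X A Ds).trans ?_
    rw [spine_addLeaves]
    refine (hA _).trans ?_
    rw [← spine_addLeaves, ← addLeaves_add, carets, add_assoc]
    exact .refl _

theorem connected_of_carets_eq {S T : Shape} (h : S.carets = T.carets) : Connected S T := by
  have h1 := connected_comb S []
  have h2 := connected_comb T []
  rw [h] at h1
  exact h1.trans h2.symm

theorem Shape.carets_addLeaves (A : Shape) (k : ℕ) : (A.addLeaves k).carets = A.carets + k := by
  induction k with
  | zero => rfl
  | succ k ih => rw [addLeaves, carets, ih, carets]; omega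

/-! ### Homeomorphisms are determined by their blocks. -/

/-- The intervals at the leaves when `i` is subdivided along a tree. -/
def leafParts : Shape → ℝ × ℝ → Set (ℝ × ℝ)
  | leaf, i => {i}
  | node l r, i => leafParts l (leftPart i) ∪ leafParts r (rightPart i)

/-- The intervals under the primary arcs that subdivide `i` along a tree. -/
def midParts : Shape → ℝ × ℝ → Set (ℝ × ℝ)
  | leaf, _ => ∅
  | node l r, i => insert (midPart i) (midParts l (leftPart i) ∪ midParts r (rightPart i))

theorem exists_fst_mem_blocks (T : Shape) (i u x : ℝ × ℝ) :
    (∃ b ∈ blocks T i u, b.1 = x) ↔ x ∈ leafParts T i := by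
  induction T generalizing i u with
  | leaf => simp [blocks, leafParts, eq_comm]
  | node l r hl hr =>
    simp only [blocks, leafParts, List.mem_append, or_and_right, exists_or, hl, hr, Set.mem_union]

theorem exists_snd_mem_blocks (T : Shape) (i u x : ℝ × ℝ) :
    (∃ b ∈ blocks T i u, b.2 = x) ↔ x ∈ insert u (midParts T i) := by
  induction T generalizing i u with
  | leaf => simp [blocks, midParts, eq_comm]
  | node l r hl hr =>
    simp only [blocks, midParts, List.mem_append, or_and_right, exists_or, hl, hr, Set.mem_union,
      Set.mem_insert_iff]
    tauto

theorem exists_mem_parts (T : Shape) (i : ℝ × ℝ) {x : ℝ} (h1 : i.1 ≤ x) (h2 : x ≤ i.2) :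
    ∃ j ∈ leafParts T i ∪ midParts T i, j.1 ≤ x ∧ x ≤ j.2 := by
  induction T generalizing i with
  | leaf => exact ⟨i, by simp [leafParts], h1, h2⟩
  | node l r hl hr =>
    rcases le_total x (leftPart i).2 with h | h
    · obtain ⟨j, hj, hj'⟩ := hl (leftPart i) h1 h
      refine ⟨j, ?_, hj'⟩
      rcases hj with hj | hj <;> simp [leafParts, midParts, hj]
    rcases le_total x (rightPart i).1 with h' | h'
    · exact ⟨midPart i, by simp [midParts], h, h'⟩
    · obtain ⟨j, hj, hj'⟩ := hr (rightPart i) h' h2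
      refine ⟨j, ?_, hj'⟩
      rcases hj with hj | hj <;> simp [leafParts, midParts, hj]

theorem MapsLinearly.apply_eq {f g : UnitAddCircle ≃ₜ UnitAddCircle} {i j : ℝ × ℝ}
    (hf : MapsLinearly f i j) (hg : MapsLinearly g i j) {x : ℝ} (h1 : i.1 ≤ x) (h2 : x ≤ i.2) :
    f (x : UnitAddCircle) = g (x : UnitAddCircle) := by
  obtain ⟨t, ht, rfl⟩ : ∃ t ∈ Set.Icc (0 : ℝ) 1, i.1 + t * (i.2 - i.1) = x := by
    rcases (h1.trans h2).eq_or_lt with h | h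
    · exact ⟨0, by simp, by linarith⟩
    · have h' : 0 < i.2 - i.1 := by linarith
      refine ⟨(x - i.1) / (i.2 - i.1), ⟨by apply div_nonneg <;> linarith, ?_⟩, by field_simp; ring⟩
      rw [div_le_one h']; linarith
  rw [hf t ht, hg t ht]

/-- One `b` serves both relations because they compare the same positions; hence two maps with the
same block data send a piece to the same piece. -/
theorem exists_of_forall₂ {α β : Type*} {R R' : α → β → Prop} {l : List α} {m : List β}
    (h : List.Forall₂ R l m) (h' : List.Forall₂ R' l m) {a : α} (ha : a ∈ l) :
    ∃ b ∈ m, R a b ∧ R' a b := by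
  induction h with
  | nil => simp at ha
  | cons h _ ih =>
    cases h' with
    | cons k k' =>
      rcases List.mem_cons.1 ha with rfl | ha
      · exact ⟨_, by simp, h, k⟩
      · obtain ⟨b, hb, hb'⟩ := ih k' ha
        exact ⟨b, by simp [hb], hb'⟩

/-- Leaves and intervals under arcs together cover the circle, and linearity fixes both maps on each
of them. -/
theorem eq_of_mapsBlock {f g : UnitAddCircle ≃ₜ UnitAddCircle} {S : Shape}
    {l : List ((ℝ × ℝ) × (ℝ × ℝ))} (hf : List.Forall₂ (MapsBlock f) (circleBlocks S) l)
    (hg : List.Forall₂ (MapsBlock g) (circleBlocks S) l) : f = g := by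
  ext θ
  obtain ⟨x, ⟨hx1, hx2⟩, rfl⟩ : ∃ x ∈ Set.Ico (1 / 6 : ℝ) (1 / 6 + 1), (x : UnitAddCircle) = θ := by
    have h3 : θ ∈ ((↑) : ℝ → UnitAddCircle) '' Set.Ico (1 / 6 : ℝ) (1 / 6 + 1) := by
      rw [AddCircle.coe_image_Ico_eq]; trivial
    exact h3
  have hsnd : ∀ j ∈ insert (-(1 / 6), 1 / 6) (midParts S (1 / 6, 5 / 6)), ∀ y : ℝ, j.1 ≤ y →
      y ≤ j.2 → f (y : UnitAddCircle) = g (y : UnitAddCircle) := by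
    intro j hj y h1 h2
    obtain ⟨b, hb, rfl⟩ := (exists_snd_mem_blocks S _ _ j).2 hj
    obtain ⟨c, -, h, h'⟩ := exists_of_forall₂ hf hg hb
    exact h.2.apply_eq h'.2 h1 h2
  rcases le_total x (5 / 6) with h | h
  · obtain ⟨j, hj | hj, h1, h2⟩ := exists_mem_parts S (1 / 6, 5 / 6) hx1 h
    · obtain ⟨b, hb, rfl⟩ := (exists_fst_mem_blocks S _ (-(1 / 6), 1 / 6) j).2 hj
      obtain ⟨c, -, h, h'⟩ := exists_of_forall₂ hf hg hb
      exact h.1.apply_eq h'.1 h1 h2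
    · exact hsnd j (.inr hj) x h1 h2
  · have := hsnd _ (.inl rfl) (x - 1) (by linarith) (by linarith)
    rwa [← AddCircle.coe_add_period, sub_add_cancel] at this

theorem IsTreeMap.mem_closure {f : UnitAddCircle ≃ₜ UnitAddCircle} (hf : IsTreeMap f) :
    f ∈ Subgroup.closure {beta, gamma, delta} := by
  obtain ⟨S, T, l, -, hl, h⟩ := hf
  have hST := carets_eq hl h
  obtain ⟨k, hk, rfl⟩ := List.isRotated_iff_mod.1 hl.symm
  -- It is enough to undo the cyclic rotation by a generated map: the composite then preserves the
  -- order of leaves, so it coincides with a map provided by `connected_of_carets_eq`.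
  suffices ∃ g ∈ Subgroup.closure {beta, gamma, delta}, ∃ T' : Shape, T'.carets = T.carets ∧
      List.Forall₂ (MapsBlock g) ((circleBlocks T).rotate k) (circleBlocks T') by
    obtain ⟨g, hg, T', hT', h'⟩ := this
    obtain ⟨g', hg', h''⟩ := connected_of_carets_eq (hST.trans hT'.symm)
    rw [← eq_of_mapsBlock (forall₂_mapsBlock_trans h h') h''] at hg'
    simpa using mul_mem (inv_mem hg) hg'
  rw [length_circleBlocks] at hk
  rcases Nat.eq_zero_or_pos k with rfl | h0
  · exact ⟨1, one_mem _, T, rfl, by simpa using forall₂_mapsBlock_refl _⟩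
  rcases hk.eq_or_lt with rfl | hk
  · refine ⟨1, one_mem _, T, rfl, ?_⟩
    rw [← length_circleBlocks, List.rotate_length]
    exact forall₂_mapsBlock_refl _
  -- `A` has exactly `k` leaves and `B` has the others, so the swap of `A` and `B` rotates by `k`.
  -- Both need a leaf, which is why the trivial rotations by $0$ and by the full length were split
  -- off.
  let A := leaf.addLeaves (k - 1)
  let B := leaf.addLeaves (T.carets - k)
  have hA : A.carets + 1 = k := by simp only [A, carets_addLeaves, carets]; omega
  have hB : B.carets = T.carets - k := by simp only [B, carets_addLeaves, carets]; omega
  have hAB : T.carets = (node A B).carets := by rw [carets]; omega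
  obtain ⟨g, hg, h'⟩ := connected_of_carets_eq hAB
  obtain ⟨m, hm, hm'⟩ := delta_swap A B
  refine ⟨delta * g, mul_mem (Subgroup.subset_closure (by simp)) hg, node B A,
    by rw [carets]; omega, ?_⟩
  rw [hm', hA]
  exact forall₂_rotate (forall₂_mapsBlock_trans h' hm) k

theorem closure_eq_treeMaps : Subgroup.closure {beta, gamma, delta} = treeMaps := by
  refine le_antisymm ((Subgroup.closure_le _).2 ?_) fun f hf => IsTreeMap.mem_closure hf
  rintro f (rfl | rfl | rfl)
  exacts [isTreeMap_beta, isTreeMap_gamma, isTreeMap_delta]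

/-! ### The intervals between central arcs -/

/-- The intervals obtained from `[1/6, 5/6]` by repeatedly passing to the first or to the last
quarter, described by the two similarities that map `[1/6, 5/6]` to these quarters. -/
inductive IsGapInterval : ℝ × ℝ → Prop
  | root : IsGapInterval (1 / 6, 5 / 6)
  | left {i : ℝ × ℝ} : IsGapInterval i → IsGapInterval (i.1 / 4 + 1 / 8, i.2 / 4 + 1 / 8)
  | right {i : ℝ × ℝ} : IsGapInterval i → IsGapInterval (i.1 / 4 + 5 / 8, i.2 / 4 + 5 / 8)

/-- Similarities commute with taking quarters, so building intervals by outer similarities, as in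
`IsGapInterval`, is compatible with subdividing from the inside, as trees do. -/
theorem IsGapInterval.leftPart {i : ℝ × ℝ} (h : IsGapInterval i) :
    IsGapInterval (leftPart i) := by
  induction h with
  | root => convert IsGapInterval.root.left using 1; norm_num [Basilica.leftPart]
  | left _ ih =>
    convert ih.left using 1
    simp only [Basilica.leftPart]
    congr 1; ring
  | right _ ih =>
    convert ih.right using 1
    simp only [Basilica.leftPart]
    congr 1; ring

theorem IsGapInterval.rightPart {i : ℝ × ℝ} (h : IsGapInterval i) :
    IsGapInterval (rightPart i) := by
  induction h with
  | root => convert IsGapInterval.root.right using 1; norm_num [Basilica.rightPart]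
  | left _ ih =>
    convert ih.left using 1
    simp only [Basilica.rightPart]
    congr 1; ring
  | right _ ih =>
    convert ih.right using 1
    simp only [Basilica.rightPart]
    congr 1; ring

theorem IsGapInterval.bounds {i : ℝ × ℝ} (h : IsGapInterval i) :
    1 / 6 ≤ i.1 ∧ i.1 < i.2 ∧ i.2 ≤ 5 / 6 := by
  induction h with
  | root => norm_num
  | left _ ih => obtain ⟨h1, h2, h3⟩ := ih; refine ⟨?_, ?_, ?_⟩ <;> simp only <;> linarith
  | right _ ih => obtain ⟨h1, h2, h3⟩ := ih; refine ⟨?_, ?_, ?_⟩ <;> simp only <;> linarith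

theorem IsGapInterval.mem_parts {T : Shape} {i : ℝ × ℝ} (h : IsGapInterval i) :
    (∀ j ∈ leafParts T i, IsGapInterval j) ∧
      ∀ j ∈ midParts T i, ∃ k, IsGapInterval k ∧ j = midPart k := by
  induction T generalizing i with
  | leaf => exact ⟨fun j hj => by rwa [Set.mem_singleton_iff.1 hj], fun j hj => hj.elim⟩
  | node l r hl hr =>
    obtain ⟨h1, h2⟩ := hl h.leftPart
    obtain ⟨h3, h4⟩ := hr h.rightPart
    refine ⟨fun j hj => hj.elim (h1 j) (h3 j), fun j hj => ?_⟩
    rcases hj with rfl | hj | hj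
    exacts [⟨i, h, rfl⟩, h2 j hj, h4 j hj]

/-- The intervals that lie under central arcs. -/
def IsCapInterval (u : ℝ × ℝ) : Prop :=
  u = (-(1 / 6), 1 / 6) ∨ ∃ i, IsGapInterval i ∧ u = midPart i

theorem IsCapInterval.width {u : ℝ × ℝ} (h : IsCapInterval u) : u.1 < u.2 ∧ u.2 - u.1 ≤ 1 / 3 := by
  rcases h with rfl | ⟨i, h, rfl⟩
  · norm_num
  · obtain ⟨h1, h2, h3⟩ := h.bounds
    constructor <;> simp only [midPart] <;> linarith

/-- The point `x` does not lie in the interior of `[1/6, 5/6]` under a central arc. -/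
def IsExposed (x : ℝ) : Prop :=
  (1 / 6 ≤ x ∧ x ≤ 5 / 6) ∧ ∀ j, IsGapInterval j → x ≤ (midPart j).1 ∨ (midPart j).2 ≤ x

theorem IsExposed.left {x : ℝ} (h : IsExposed x) : IsExposed (x / 4 + 1 / 8) := by
  obtain ⟨⟨h1, h2⟩, h⟩ := h
  refine ⟨⟨by linarith, by linarith⟩, fun j hj => ?_⟩
  cases hj with
  | root => left; simp only [midPart]; linarith
  | left hj =>
    refine (h _ hj).imp ?_ ?_ <;> intro h <;> simp only [midPart] at h ⊢ <;> linarith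
  | right hj => left; have := hj.bounds; simp only [midPart]; linarith

theorem IsExposed.right {x : ℝ} (h : IsExposed x) : IsExposed (x / 4 + 5 / 8) := by
  obtain ⟨⟨h1, h2⟩, h⟩ := h
  refine ⟨⟨by linarith, by linarith⟩, fun j hj => ?_⟩
  cases hj with
  | root => right; simp only [midPart]; linarith
  | right hj =>
    refine (h _ hj).imp ?_ ?_ <;> intro h <;> simp only [midPart] at h ⊢ <;> linarith
  | left hj => right; have := hj.bounds; simp only [midPart]; linarith

theorem isExposed_one_sixth : IsExposed (1 / 6) :=
  ⟨by norm_num, fun j hj => by have := hj.bounds; left; simp only [midPart]; linarith⟩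

theorem isExposed_five_sixths : IsExposed (5 / 6) :=
  ⟨by norm_num, fun j hj => by have := hj.bounds; right; simp only [midPart]; linarith⟩

/-- The ends $1/3$ and $2/3$ of the root's arc are images of $5/6$ and $1/6$ under the two
similarities; deeper arcs follow by self-similarity. -/
theorem IsGapInterval.isExposed_midPart {i : ℝ × ℝ} (h : IsGapInterval i) :
    IsExposed (midPart i).1 ∧ IsExposed (midPart i).2 := by
  induction h with
  | root =>
    constructor
    · convert isExposed_five_sixths.left using 1; norm_num [midPart]
    · convert isExposed_one_sixth.right using 1; norm_num [midPart]
  | left _ ih =>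
    constructor
    · convert ih.1.left using 1; simp only [midPart]; ring
    · convert ih.2.left using 1; simp only [midPart]; ring
  | right _ ih =>
    constructor
    · convert ih.1.right using 1; simp only [midPart]; ring
    · convert ih.2.right using 1; simp only [midPart]; ring

theorem coe_neg_one_sixth : ((-(1 / 6) : ℝ) : UnitAddCircle) = ((5 / 6 : ℝ) : UnitAddCircle) :=
  (coe_eq_coe_iff _ _).2 ⟨1, by norm_num⟩

theorem IsCapInterval.exists_isExposed {u : ℝ × ℝ} (h : IsCapInterval u) :
    ∃ x y, IsExposed x ∧ IsExposed y ∧ (u.1 : UnitAddCircle) = x ∧ (u.2 : UnitAddCircle) = y := by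
  rcases h with rfl | ⟨i, h, rfl⟩
  · exact ⟨5 / 6, 1 / 6, isExposed_five_sixths, isExposed_one_sixth, coe_neg_one_sixth, rfl⟩
  · exact ⟨_, _, h.isExposed_midPart.1, h.isExposed_midPart.2, rfl, rfl⟩

/-! ### Central arcs compared with the dyadic arcs of the lamination. -/

/-- The arc over an interval. -/
def arcOver (u : ℝ × ℝ) : Sym2 UnitAddCircle := s((u.1 : UnitAddCircle), (u.2 : UnitAddCircle))

/-- Halving the width about the center turns $(k\pm1/3)/4^{m+1}$ into $(k\pm1/6)/4^{m+1}$, a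
lamination arc with $n=2(m+1)$. The root is exceptional and yields the arc $\{1/3,2/3\}$. -/
theorem IsGapInterval.eq_dyadic {i : ℝ × ℝ} (h : IsGapInterval i) :
    i = (1 / 6, 5 / 6) ∨ ∃ (k : ℤ) (m : ℕ),
      i = (((k : ℝ) - 1 / 3) / 4 ^ (m + 1), ((k : ℝ) + 1 / 3) / 4 ^ (m + 1)) := by
  induction h with
  | root => exact .inl rfl
  | left _ ih =>
    right
    rcases ih with rfl | ⟨k, m, rfl⟩
    · exact ⟨1, 0, by norm_num⟩
    · refine ⟨k + 2 * 4 ^ m, m + 1, ?_⟩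
      push_cast
      ext <;> simp only <;> field_simp <;> ring
  | right _ ih =>
    right
    rcases ih with rfl | ⟨k, m, rfl⟩
    · exact ⟨3, 0, by norm_num⟩
    · refine ⟨k + 10 * 4 ^ m, m + 1, ?_⟩
      push_cast
      ext <;> simp only <;> field_simp <;> ring

theorem IsCapInterval.arcOver_mem_lamination {u : ℝ × ℝ} (h : IsCapInterval u) :
    arcOver u ∈ lamination := by
  rcases h with rfl | ⟨i, h, rfl⟩
  · exact .inr ⟨0, 0, by simp [arcOver]⟩
  · rcases h.eq_dyadic with rfl | ⟨k, m, rfl⟩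
    · left
      norm_num [arcOver, midPart]
    · right
      refine ⟨k, 2 * (m + 1), ?_⟩
      rw [pow_mul, show (2 : ℝ) ^ 2 = 4 by norm_num]
      simp only [arcOver, midPart]
      congr 3 <;> field_simp <;> ring

/-- Excludes the borderline case in which an arc would straddle an endpoint of an interval. -/
theorem six_mul_ne_two_pow (k : ℤ) (m : ℕ) : 6 * k ≠ 2 ^ m := by
  intro h
  have h3 : (3 : ℤ) ∣ 2 ^ m := ⟨2 * k, by rw [← h]; ring⟩
  have := Int.prime_three.dvd_of_dvd_pow h3
  omega

/-- The bound on `k` says that the arc centered at $1/2+k/2^n$ lies over part of $[1/6,5/6]$. Either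
it lies under $\{1/3,2/3\}$, or it lies in an outer quarter; magnifying that quarter by $4$ lowers
`n` by $2$ and replaces `k` by $k\mp2^n$. -/
theorem exists_gapInterval_of_dyadic : ∀ (n : ℕ) (k : ℤ), 6 * |k| + 1 ≤ 2 ^ (n + 1) →
    ∃ i, IsGapInterval i ∧ (midPart i).1 ≤ 1 / 2 + (k - 1 / 6) / 2 ^ n ∧
      1 / 2 + (k + 1 / 6) / 2 ^ n ≤ (midPart i).2
  | 0, k, h => by
    obtain rfl : k = 0 := by
      rw [← abs_eq_zero]; have := abs_nonneg k; norm_num at h; omega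
    exact ⟨_, .root, by norm_num [midPart], by norm_num [midPart]⟩
  | 1, k, h => by
    obtain rfl : k = 0 := by
      rw [← abs_eq_zero]; have := abs_nonneg k; norm_num at h; omega
    exact ⟨_, .root, by norm_num [midPart], by norm_num [midPart]⟩
  | n + 2, k, h => by
    have hne := six_mul_ne_two_pow |k| (n + 2)
    have hpos : (0 : ℝ) < 2 ^ n := by positivity
    have e1 : (2 : ℤ) ^ (n + 2 + 1) = 8 * 2 ^ n := by ring
    have e2 : (2 : ℤ) ^ (n + 2) = 4 * 2 ^ n := by ring
    have e3 : (2 : ℤ) ^ (n + 1) = 2 * 2 ^ n := by ring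
    have e4 : (2 : ℝ) ^ (n + 2) = 4 * 2 ^ n := by ring
    rw [e1] at h
    rw [e2] at hne
    rw [e4]
    rcases le_or_gt (6 * |k| + 1) (4 * 2 ^ n) with h1 | h1
    · refine ⟨_, .root, ?_⟩
      have h2 : 6 * |(k : ℝ)| + 1 ≤ 4 * 2 ^ n := by exact_mod_cast h1
      have h3 := neg_abs_le (k : ℝ)
      have h4 := le_abs_self (k : ℝ)
      have h5 : -(1 / 6) ≤ ((k : ℝ) - 1 / 6) / (4 * 2 ^ n) := by
        rw [le_div_iff₀ (by positivity)]; linarith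
      have h6 : ((k : ℝ) + 1 / 6) / (4 * 2 ^ n) ≤ 1 / 6 := by
        rw [div_le_iff₀ (by positivity)]; linarith
      simp only [midPart]
      constructor <;> linarith
    · rcases le_total 0 k with hk | hk
      · rw [abs_of_nonneg hk] at h h1 hne
        obtain ⟨i, hi, h2, h3⟩ := exists_gapInterval_of_dyadic n (k - 2 ^ n) (by
          rw [e3]
          have : |k - 2 ^ n| * 6 ≤ 2 * 2 ^ n - 1 := by
            rcases abs_cases (k - 2 ^ n) with ⟨h, -⟩ | ⟨h, -⟩ <;> rw [h] <;> omega
          omega)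
        refine ⟨_, hi.right, ?_⟩
        push_cast at h2 h3
        have a1 : ((k : ℝ) - 1 / 6) / (4 * 2 ^ n) =
            1 / 4 + ((k : ℝ) - 2 ^ n - 1 / 6) / 2 ^ n / 4 := by field_simp; ring
        have a2 : ((k : ℝ) + 1 / 6) / (4 * 2 ^ n) =
            1 / 4 + ((k : ℝ) - 2 ^ n + 1 / 6) / 2 ^ n / 4 := by field_simp; ring
        rw [a1, a2]
        simp only [midPart] at h2 h3 ⊢
        constructor <;> linarith
      · rw [abs_of_nonpos hk] at h h1 hne
        obtain ⟨i, hi, h2, h3⟩ := exists_gapInterval_of_dyadic n (k + 2 ^ n) (by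
          rw [e3]
          have : |k + 2 ^ n| * 6 ≤ 2 * 2 ^ n - 1 := by
            rcases abs_cases (k + 2 ^ n) with ⟨h, -⟩ | ⟨h, -⟩ <;> rw [h] <;> omega
          omega)
        refine ⟨_, hi.left, ?_⟩
        push_cast at h2 h3
        have a1 : ((k : ℝ) - 1 / 6) / (4 * 2 ^ n) =
            -(1 / 4) + ((k : ℝ) + 2 ^ n - 1 / 6) / 2 ^ n / 4 := by field_simp; ring
        have a2 : ((k : ℝ) + 1 / 6) / (4 * 2 ^ n) =
            -(1 / 4) + ((k : ℝ) + 2 ^ n + 1 / 6) / 2 ^ n / 4 := by field_simp; ring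
        rw [a1, a2]
        simp only [midPart] at h2 h3 ⊢
        constructor <;> linarith

theorem exists_capInterval_of_mem_lamination {e : Sym2 UnitAddCircle} (he : e ∈ lamination) :
    ∃ u, IsCapInterval u ∧ ∃ p q : ℝ, u.1 ≤ p ∧ p ≤ q ∧ q ≤ u.2 ∧ e = arcOver (p, q) := by
  rcases he with rfl | ⟨k, n, rfl⟩
  · exact ⟨_, .inr ⟨_, .root, rfl⟩, 1 / 3, 2 / 3, by norm_num [midPart], by norm_num,
      by norm_num [midPart], rfl⟩
  have hmk : ∀ (u : ℝ × ℝ) (m : ℤ), IsCapInterval u → u.1 ≤ (k - 1 / 6) / 2 ^ n + m →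
      (k + 1 / 6) / 2 ^ n + m ≤ u.2 → ∃ u, IsCapInterval u ∧ ∃ p q : ℝ, u.1 ≤ p ∧ p ≤ q ∧
        q ≤ u.2 ∧ s(((((k : ℝ) - 1 / 6) / 2 ^ n : ℝ) : UnitAddCircle),
          ((((k : ℝ) + 1 / 6) / 2 ^ n : ℝ) : UnitAddCircle)) = arcOver (p, q) := by
    intro u m hu h1 h2
    refine ⟨u, hu, _, _, h1, ?_, h2, ?_⟩
    · gcongr; linarith
    · simp only [arcOver]
      rw [(coe_eq_coe_iff _ _).2 ⟨m, rfl⟩, (coe_eq_coe_iff ((k + 1 / 6) / 2 ^ n) _).2 ⟨m, rfl⟩]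
  cases n with
  | zero => exact hmk _ (-k) (.inl rfl) (by simp) (by simp)
  | succ n =>
    have hp : (0 : ℝ) < 2 ^ n := by positivity
    have hp' : (0 : ℤ) < 2 ^ (n + 1) := by positivity
    obtain ⟨k₀, m, h0, h1, rfl⟩ : ∃ k₀ m : ℤ, 0 ≤ k₀ ∧ k₀ < 2 ^ (n + 1) ∧
        k = k₀ + m * 2 ^ (n + 1) :=
      ⟨k % 2 ^ (n + 1), k / 2 ^ (n + 1), Int.emod_nonneg _ hp'.ne', Int.emod_lt_of_pos _ hp',
        (Int.emod_add_ediv_mul _ _).symm⟩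
    have e1 : ∀ s : ℝ, (((k₀ + m * 2 ^ (n + 1) : ℤ) : ℝ) + s) / 2 ^ (n + 1) =
        (k₀ + s) / 2 ^ (n + 1) + m := by intro s; push_cast; field_simp; ring
    have e1' : (((k₀ + m * 2 ^ (n + 1) : ℤ) : ℝ) - 1 / 6) / 2 ^ (n + 1) =
        (k₀ - 1 / 6) / 2 ^ (n + 1) + m := by simpa only [sub_eq_add_neg] using e1 (-(1 / 6))
    rw [e1', e1] at hmk ⊢
    have e2 : (2 : ℤ) ^ (n + 1) = 2 * 2 ^ n := by ring
    have e3 : (2 : ℤ) ^ (n + 1 + 1) = 4 * 2 ^ n := by ring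
    have e4 : (2 : ℝ) ^ (n + 1) = 2 * 2 ^ n := by ring
    -- The center is measured from $1/2=2^n/2^{n+1}$. An arc that does not lie in $[1/6,5/6]$ lies
    -- in $[-1/6,1/6]$ or in its translate $[5/6,7/6]$.
    rcases le_or_gt (6 * |k₀ - 2 ^ n| + 1) (2 ^ (n + 1 + 1)) with h | h
    · obtain ⟨i, hi, h2, h3⟩ := exists_gapInterval_of_dyadic (n + 1) _ h
      push_cast at h2 h3
      refine hmk _ (-m) (.inr ⟨i, hi, rfl⟩) (h2.trans ?_) (le_trans ?_ h3)
      · push_cast; rw [e4]; apply le_of_eq; field_simp; ring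
      · push_cast; rw [e4]; apply le_of_eq; field_simp; ring
    · have hne := six_mul_ne_two_pow |k₀ - 2 ^ n| (n + 1 + 1)
      rw [e3] at h hne
      rw [e2] at h1
      rcases le_total 0 (k₀ - 2 ^ n) with hk | hk
      · rw [abs_of_nonneg hk] at h hne
        have h2 : (10 : ℝ) * 2 ^ n + 1 ≤ 6 * k₀ := by
          have : (10 : ℤ) * 2 ^ n + 1 ≤ 6 * k₀ := by omega
          exact_mod_cast this
        have h3 : (k₀ : ℝ) + 1 ≤ 2 * 2 ^ n := by
          have : k₀ + 1 ≤ 2 * 2 ^ n := by omega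
          exact_mod_cast this
        have h4 : 5 / 6 ≤ ((k₀ : ℝ) - 1 / 6) / (2 * 2 ^ n) := by
          rw [le_div_iff₀ (by positivity)]; linarith
        have h5 : ((k₀ : ℝ) + 1 / 6) / (2 * 2 ^ n) ≤ 7 / 6 := by
          rw [div_le_iff₀ (by positivity)]; linarith
        refine hmk _ (-m - 1) (.inl rfl) ?_ ?_ <;> push_cast <;> rw [e4] <;> linarith
      · rw [abs_of_nonpos hk] at h hne
        have h2 : (6 : ℝ) * k₀ + 1 ≤ 2 * 2 ^ n := by
          have : 6 * k₀ + 1 ≤ 2 * 2 ^ n := by omega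
          exact_mod_cast this
        have h3 : (0 : ℝ) ≤ k₀ := by exact_mod_cast h0
        have h3' : (1 : ℝ) ≤ 2 ^ n := one_le_pow₀ (by norm_num)
        have h4 : -(1 / 6) ≤ ((k₀ : ℝ) - 1 / 6) / (2 * 2 ^ n) := by
          rw [le_div_iff₀ (by positivity)]; linarith
        have h5 : ((k₀ : ℝ) + 1 / 6) / (2 * 2 ^ n) ≤ 1 / 6 := by
          rw [div_le_iff₀ (by positivity)]; linarith
        refine hmk _ (-m) (.inl rfl) ?_ ?_ <;> push_cast <;> rw [e4] <;> linarith

/-! ### The central gap -/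

/-- The line over an interval `u` is given by the equation `side u z = rim u`. -/
noncomputable def side (u : ℝ × ℝ) (z : ℂ) : ℝ :=
  z.re * Real.cos (Real.pi * (u.1 + u.2)) + z.im * Real.sin (Real.pi * (u.1 + u.2))

/-- The distance of the line over an interval from the center of the disk. -/
noncomputable def rim (u : ℝ × ℝ) : ℝ := Real.cos (Real.pi * (u.2 - u.1))

theorem toCircle_coe (x : ℝ) : ((AddCircle.toCircle (x : UnitAddCircle) : Circle) : ℂ) =
    ⟨Real.cos (2 * Real.pi * x), Real.sin (2 * Real.pi * x)⟩ := by
  have key : ∀ y : ℝ, Complex.exp (y * Complex.I) = ⟨Real.cos y, Real.sin y⟩ := fun y => by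
    rw [Complex.exp_mul_I]
    apply Complex.ext <;> simp [Complex.cos_ofReal_re, Complex.sin_ofReal_re]
  rw [AddCircle.toCircle_apply_mk, Circle.coe_exp, key, div_one]

theorem side_toCircle (u : ℝ × ℝ) (x : ℝ) :
    side u (AddCircle.toCircle (x : UnitAddCircle) : Circle) =
      Real.cos (Real.pi * (2 * x - u.1 - u.2)) := by
  rw [toCircle_coe, side, ← Real.cos_sub]
  congr 1; ring

theorem side_comb (u : ℝ × ℝ) (a b : ℝ) (z w : ℂ) :
    side u (a • z + b • w) = a * side u z + b * side u w := by
  simp [side]; ring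

theorem side_smul (u : ℝ × ℝ) (a : ℝ) (z : ℂ) : side u (a • z) = a * side u z := by
  simp [side]; ring

theorem continuous_side (u : ℝ × ℝ) : Continuous (side u) := by
  unfold side; fun_prop

theorem rim_le_side {u : ℝ × ℝ} (hu : u.2 - u.1 ≤ 1) {x : ℝ} (h1 : u.1 ≤ x) (h2 : x ≤ u.2) :
    rim u ≤ side u (AddCircle.toCircle (x : UnitAddCircle) : Circle) := by
  rw [side_toCircle, rim, ← Real.cos_abs (Real.pi * (2 * x - u.1 - u.2)), abs_mul,
    abs_of_pos Real.pi_pos]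
  refine Real.cos_le_cos_of_nonneg_of_le_pi (by positivity) ?_ ?_
  · nlinarith [Real.pi_pos]
  · refine mul_le_mul_of_nonneg_left (abs_le.2 ⟨?_, ?_⟩) Real.pi_pos.le <;> linarith

theorem rim_lt_side {u : ℝ × ℝ} (hu : u.2 - u.1 ≤ 1) {x : ℝ} (h1 : u.1 < x) (h2 : x < u.2) :
    rim u < side u (AddCircle.toCircle (x : UnitAddCircle) : Circle) := by
  rw [side_toCircle, rim, ← Real.cos_abs (Real.pi * (2 * x - u.1 - u.2)), abs_mul,
    abs_of_pos Real.pi_pos]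
  refine Real.cos_lt_cos_of_nonneg_of_le_pi (by positivity) ?_ ?_
  · nlinarith [Real.pi_pos]
  · refine mul_lt_mul_of_pos_left (abs_lt.2 ⟨?_, ?_⟩) Real.pi_pos <;> linarith

theorem side_le_rim {u : ℝ × ℝ} (hu : 0 ≤ u.2 - u.1) {x : ℝ}
    (h1 : u.2 - u.1 ≤ |2 * x - u.1 - u.2|) (h2 : |2 * x - u.1 - u.2| ≤ 2 - (u.2 - u.1)) :
    side u (AddCircle.toCircle (x : UnitAddCircle) : Circle) ≤ rim u := by
  rw [side_toCircle, rim, ← Real.cos_abs (Real.pi * (2 * x - u.1 - u.2)), abs_mul,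
    abs_of_pos Real.pi_pos]
  rcases le_total |2 * x - u.1 - u.2| 1 with h | h
  · refine Real.cos_le_cos_of_nonneg_of_le_pi (mul_nonneg Real.pi_pos.le hu) ?_ ?_ <;>
      nlinarith [Real.pi_pos]
  · rw [← Real.cos_two_pi_sub]
    refine Real.cos_le_cos_of_nonneg_of_le_pi (mul_nonneg Real.pi_pos.le hu) ?_ ?_ <;>
      nlinarith [Real.pi_pos]

theorem IsCapInterval.rim_pos {u : ℝ × ℝ} (h : IsCapInterval u) : 0 < rim u := by
  have := h.width
  refine Real.cos_pos_of_mem_Ioo ⟨?_, ?_⟩ <;> nlinarith [Real.pi_pos]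

theorem IsCapInterval.side_le_rim {u : ℝ × ℝ} (h : IsCapInterval u) {x : ℝ} (hx : IsExposed x) :
    side u (AddCircle.toCircle (x : UnitAddCircle) : Circle) ≤ rim u := by
  have hw := h.width
  obtain ⟨⟨h1, h2⟩, h3⟩ := hx
  rcases h with rfl | ⟨i, hi, rfl⟩
  · refine Basilica.side_le_rim (by linarith) ?_ ?_
    · refine le_trans ?_ (le_abs_self _); simp only; linarith
    · refine abs_le.2 ⟨?_, ?_⟩ <;> simp only <;> linarith
  · have hb := hi.bounds
    refine Basilica.side_le_rim (by linarith) ?_ ?_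
    · rcases h3 i hi with h | h
      · refine le_trans ?_ (neg_le_abs _); linarith
      · refine le_trans ?_ (le_abs_self _); linarith
    · simp only [midPart]
      refine abs_le.2 ⟨?_, ?_⟩ <;> linarith

theorem mem_chord {p q : UnitAddCircle} {z : ℂ} : z ∈ chord s(p, q) ↔
    ∃ a b : ℝ, 0 < a ∧ 0 < b ∧ a + b = 1 ∧
      a • (AddCircle.toCircle p : ℂ) + b • (AddCircle.toCircle q : ℂ) = z := Iff.rfl

theorem side_le_of_mem_chord {u : ℝ × ℝ} {p q : UnitAddCircle} {z : ℂ} {r : ℝ}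
    (hz : z ∈ chord s(p, q)) (hp : side u (AddCircle.toCircle p : Circle) ≤ r)
    (hq : side u (AddCircle.toCircle q : Circle) ≤ r) : side u z ≤ r := by
  obtain ⟨a, b, ha, hb, hab, rfl⟩ := mem_chord.1 hz
  rw [side_comb]
  have : a * r + b * r = r := by rw [← add_mul, hab, one_mul]
  linarith [mul_le_mul_of_nonneg_left hp ha.le, mul_le_mul_of_nonneg_left hq hb.le]

theorem le_side_of_mem_chord {u : ℝ × ℝ} {p q : UnitAddCircle} {z : ℂ} {r : ℝ}
    (hz : z ∈ chord s(p, q)) (hp : r ≤ side u (AddCircle.toCircle p : Circle))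
    (hq : r ≤ side u (AddCircle.toCircle q : Circle)) : r ≤ side u z := by
  obtain ⟨a, b, ha, hb, hab, rfl⟩ := mem_chord.1 hz
  rw [side_comb]
  have : a * r + b * r = r := by rw [← add_mul, hab, one_mul]
  linarith [mul_le_mul_of_nonneg_left hp ha.le, mul_le_mul_of_nonneg_left hq hb.le]

theorem norm_le_one_of_mem_chord {p q : UnitAddCircle} {z : ℂ} (hz : z ∈ chord s(p, q)) :
    ‖z‖ ≤ 1 := by
  obtain ⟨a, b, ha, hb, hab, rfl⟩ := mem_chord.1 hz
  refine (norm_add_le _ _).trans ?_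
  rw [norm_smul, norm_smul, Circle.norm_coe, Circle.norm_coe, Real.norm_of_nonneg ha.le,
    Real.norm_of_nonneg hb.le]
  linarith

/-- In coordinates along and across the chord, $z$ is $(s,\cos\varphi)$; $|z|<1$ forces
$|s|<\sin\varphi$, and the endpoints are at $s=\pm\sin\varphi$, which gives the convex weights. -/
theorem mem_chord_of_side_eq {u : ℝ × ℝ} (h0 : 0 < u.2 - u.1) (h1 : u.2 - u.1 < 1) {z : ℂ}
    (hz : ‖z‖ < 1) (h : side u z = rim u) : z ∈ chord (arcOver u) := by
  set ψ := Real.pi * (u.1 + u.2) with hψ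
  set φ := Real.pi * (u.2 - u.1) with hφ
  have hs : 0 < Real.sin φ :=
    Real.sin_pos_of_pos_of_lt_pi (by positivity) (by nlinarith [Real.pi_pos])
  have hside : z.re * Real.cos ψ + z.im * Real.sin ψ = Real.cos φ := h
  set s := z.im * Real.cos ψ - z.re * Real.sin ψ with hsdef
  have hψ1 := Real.sin_sq_add_cos_sq ψ
  have hφ1 := Real.sin_sq_add_cos_sq φ
  have hn : z.re ^ 2 + z.im ^ 2 < 1 := by
    have : ‖z‖ ^ 2 < 1 := by nlinarith [norm_nonneg z]
    rwa [Complex.sq_norm, Complex.normSq_apply, ← sq, ← sq] at this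
  have hsum : Real.cos φ ^ 2 + s ^ 2 = z.re ^ 2 + z.im ^ 2 := by
    rw [← hside, hsdef]
    linear_combination (z.re ^ 2 + z.im ^ 2) * hψ1
  have habs : |s| < Real.sin φ := abs_lt_of_sq_lt_sq (by linarith) hs.le
  obtain ⟨hs1, hs2⟩ := abs_lt.1 habs
  have hre : z.re = Real.cos φ * Real.cos ψ - s * Real.sin ψ := by
    rw [← hside, hsdef]; linear_combination -z.re * hψ1
  have him : z.im = Real.cos φ * Real.sin ψ + s * Real.cos ψ := by
    rw [← hside, hsdef]; linear_combination -z.im * hψ1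
  refine mem_chord.2 ⟨(1 - s / Real.sin φ) / 2, (1 + s / Real.sin φ) / 2, ?_, ?_, by ring, ?_⟩
  · have : s / Real.sin φ < 1 := by rwa [div_lt_one hs]
    linarith
  · have : -1 < s / Real.sin φ := by rw [lt_div_iff₀ hs]; linarith
    linarith
  · rw [toCircle_coe, toCircle_coe, show 2 * Real.pi * u.1 = ψ - φ by rw [hψ, hφ]; ring,
      show 2 * Real.pi * u.2 = ψ + φ by rw [hψ, hφ]; ring, Real.cos_sub, Real.cos_add, Real.sin_sub,
      Real.sin_add]
    apply Complex.ext
    · simp only [Complex.add_re, Complex.real_smul, Complex.re_ofReal_mul]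
      rw [hre]; field_simp; ring
    · simp only [Complex.add_im, Complex.real_smul, Complex.im_ofReal_mul]
      rw [him]; field_simp; ring

/-- The part of the disk on the inner side of all central arcs. -/
def innerRegion : Set ℂ := {z | ‖z‖ < 1 ∧ ∀ u, IsCapInterval u → side u z < rim u}

theorem zero_mem_innerRegion : (0 : ℂ) ∈ innerRegion :=
  ⟨by simp, fun u hu => by simpa [side] using hu.rim_pos⟩

theorem convex_innerRegion : Convex ℝ innerRegion := by
  rintro z ⟨hz, hz'⟩ w ⟨hw, hw'⟩ a b ha hb hab
  constructor
  · have := convex_ball (0 : ℂ) 1 (by simpa using hz : z ∈ Metric.ball (0 : ℂ) 1)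
      (by simpa using hw : w ∈ Metric.ball (0 : ℂ) 1) ha hb hab
    simpa using this
  · intro u hu
    have h1 := hz' u hu
    have h2 := hw' u hu
    rw [side_comb]
    rcases ha.eq_or_lt with rfl | ha
    · obtain rfl : b = 1 := by linarith
      simpa using h2
    · have : a * rim u + b * rim u = rim u := by rw [← add_mul, hab, one_mul]
      linarith [mul_lt_mul_of_pos_left h1 ha, mul_le_mul_of_nonneg_left h2.le hb]

/-- The region is convex, hence connected, and contains the center. It misses every leaf because
each leaf lies on the far side of some central arc, or on that arc. -/
theorem innerRegion_subset_centralGap : innerRegion ⊆ centralGap := by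
  refine convex_innerRegion.isPreconnected.subset_connectedComponentIn zero_mem_innerRegion ?_
  rintro z ⟨hz, hz'⟩
  refine ⟨by simpa using hz, fun h => ?_⟩
  obtain ⟨e, he, hze⟩ := Set.mem_iUnion₂.1 h
  obtain ⟨u, hu, p, q, h1, h2, h3, rfl⟩ := exists_capInterval_of_mem_lamination he
  have hw := hu.width
  exact (hz' u hu).not_ge (le_side_of_mem_chord hze (rim_le_side (by linarith) h1 (h2.trans h3))
    (rim_le_side (by linarith) (h1.trans h2) h3))

theorem centralGap_subset : centralGap ⊆
    Metric.ball (0 : ℂ) 1 \ ⋃ e ∈ lamination, chord e := connectedComponentIn_subset _ _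

/-- Otherwise, by the intermediate value theorem, the connected gap would contain a point of the
chord, which belongs to the lamination. -/
theorem side_lt_rim_of_mem_centralGap {u : ℝ × ℝ} (hu : IsCapInterval u) {z : ℂ}
    (hz : z ∈ centralGap) : side u z < rim u := by
  by_contra! h
  have h0 : side u 0 ≤ rim u := by simpa [side] using hu.rim_pos.le
  obtain ⟨w, hw, hw'⟩ := isPreconnected_connectedComponentIn.intermediate_value
    (innerRegion_subset_centralGap zero_mem_innerRegion) hz (continuous_side u).continuousOn
    ⟨h0, h⟩
  obtain ⟨h1, h2⟩ := centralGap_subset hw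
  have hwd := hu.width
  exact h2 (Set.mem_biUnion hu.arcOver_mem_lamination
    (mem_chord_of_side_eq (by linarith) (by linarith) (by simpa using h1) hw'))

theorem IsCapInterval.isCentralArc {u : ℝ × ℝ} (hu : IsCapInterval u) :
    IsCentralArc (arcOver u) := by
  refine ⟨hu.arcOver_mem_lamination, fun z hz => ⟨?_, fun h => ?_⟩⟩
  · have hlim : Filter.Tendsto (fun t : ℝ => t • z) (nhdsWithin 1 (Set.Iio 1)) (nhds z) := by
      have : Continuous fun t : ℝ => t • z := by fun_prop
      simpa using (this.tendsto 1).mono_left nhdsWithin_le_nhds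
    refine mem_closure_of_tendsto hlim ?_
    filter_upwards [Ioo_mem_nhdsLT (zero_lt_one' ℝ)] with t ht
    apply innerRegion_subset_centralGap
    constructor
    · rw [norm_smul, Real.norm_of_nonneg ht.1.le]
      have := norm_le_one_of_mem_chord hz
      nlinarith [ht.1, ht.2]
    · intro v hv
      obtain ⟨x, y, hx, hy, hx', hy'⟩ := hu.exists_isExposed
      rw [arcOver, hx', hy'] at hz
      have h1 := side_le_of_mem_chord hz (hv.side_le_rim hx) (hv.side_le_rim hy)
      rw [side_smul]
      nlinarith [ht.1, ht.2, hv.rim_pos]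
  · exact (centralGap_subset (interior_subset h)).2
      (Set.mem_biUnion hu.arcOver_mem_lamination hz)

theorem IsCapInterval.not_isCentralArc {u : ℝ × ℝ} (hu : IsCapInterval u) {p q : ℝ}
    (hp : u.1 < p) (hpq : p ≤ q) (hq : q < u.2) : ¬ IsCentralArc (arcOver (p, q)) := by
  rintro ⟨-, h⟩
  have hw := hu.width
  have hcl : closure centralGap ⊆ {z | side u z ≤ rim u} :=
    closure_minimal (fun z hz => (side_lt_rim_of_mem_centralGap hu hz).le)
      (isClosed_le (continuous_side u) continuous_const)
  have h1 := rim_lt_side (by linarith) hp (hpq.trans_lt hq)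
  have h2 := rim_lt_side (by linarith) (hp.trans_le hpq) hq
  obtain ⟨z, hz⟩ : (chord (arcOver (p, q))).Nonempty :=
    ⟨_, mem_chord.2 ⟨1 / 2, 1 / 2, by norm_num, by norm_num, by norm_num, rfl⟩⟩
  have h3 := le_side_of_mem_chord (u := u) hz (min_le_left _ _) (min_le_right _ _)
  exact absurd (hcl (h hz).1) (not_le.2 ((lt_min h1 h2).trans_le h3))

/-! ### The pieces of a subdivision -/

theorem bounds_of_mem_parts {T : Shape} {i j : ℝ × ℝ} (hi : i.1 < i.2)
    (hj : j ∈ leafParts T i ∪ midParts T i) : i.1 ≤ j.1 ∧ j.1 < j.2 ∧ j.2 ≤ i.2 := by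
  induction T generalizing i with
  | leaf =>
    obtain rfl : j = i := by simpa [leafParts, midParts] using hj
    exact ⟨le_rfl, hi, le_rfl⟩
  | node l r hl hr =>
    have hl' := @hl (leftPart i) (by simp only [leftPart]; linarith)
    have hr' := @hr (rightPart i) (by simp only [rightPart]; linarith)
    simp only [leafParts, midParts, Set.mem_union, Set.mem_insert_iff] at hj hl' hr'
    simp only [leftPart, rightPart] at hl' hr'
    rcases hj with (hj | hj) | rfl | hj | hj
    · obtain ⟨h1, h2, h3⟩ := hl' (.inl hj); refine ⟨?_, ?_, ?_⟩ <;> linarith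
    · obtain ⟨h1, h2, h3⟩ := hr' (.inl hj); refine ⟨?_, ?_, ?_⟩ <;> linarith
    · simp only [midPart]; refine ⟨?_, ?_, ?_⟩ <;> linarith
    · obtain ⟨h1, h2, h3⟩ := hl' (.inr hj); refine ⟨?_, ?_, ?_⟩ <;> linarith
    · obtain ⟨h1, h2, h3⟩ := hr' (.inr hj); refine ⟨?_, ?_, ?_⟩ <;> linarith

theorem leftPart_lt {i : ℝ × ℝ} (hi : i.1 < i.2) : (leftPart i).1 < (leftPart i).2 := by
  simp only [leftPart]; linarith

theorem rightPart_lt {i : ℝ × ℝ} (hi : i.1 < i.2) : (rightPart i).1 < (rightPart i).2 := by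
  simp only [rightPart]; linarith

/-- Two pieces of a subdivision with the same starting point agree, and are not both a leaf and an
interval under an arc. -/
theorem eq_of_start_eq {T : Shape} {i : ℝ × ℝ} (hi : i.1 < i.2) :
    (∀ j ∈ leafParts T i, ∀ k ∈ leafParts T i, j.1 = k.1 → j = k) ∧
    (∀ j ∈ midParts T i, ∀ k ∈ midParts T i, j.1 = k.1 → j = k) ∧
    (∀ j ∈ leafParts T i, ∀ k ∈ midParts T i, j.1 ≠ k.1) := by
  induction T generalizing i with
  | leaf => simp [leafParts, midParts]
  | node l r hl hr =>
    obtain ⟨l1, l2, l3⟩ := hl (leftPart_lt hi)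
    obtain ⟨r1, r2, r3⟩ := hr (rightPart_lt hi)
    have bl : ∀ j, j ∈ leafParts l (leftPart i) ∪ midParts l (leftPart i) →
        j.1 < i.1 + (i.2 - i.1) / 4 := fun j hj => by
      have := bounds_of_mem_parts (leftPart_lt hi) hj
      simp only [leftPart] at this
      linarith
    have br : ∀ j, j ∈ leafParts r (rightPart i) ∪ midParts r (rightPart i) →
        i.2 - (i.2 - i.1) / 4 ≤ j.1 := fun j hj =>
      (bounds_of_mem_parts (rightPart_lt hi) hj).1
    have hm : (midPart i).1 = i.1 + (i.2 - i.1) / 4 := rfl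
    simp only [leafParts, midParts]
    refine ⟨?_, ?_, ?_⟩
    · rintro j (hj | hj) k (hk | hk) h
      · exact l1 j hj k hk h
      · have := bl j (.inl hj); have := br k (.inl hk); linarith
      · have := br j (.inl hj); have := bl k (.inl hk); linarith
      · exact r1 j hj k hk h
    · rintro j (rfl | hj | hj) k (rfl | hk | hk) h
      · rfl
      · have := bl k (.inr hk); linarith
      · have := br k (.inr hk); linarith
      · have := bl j (.inr hj); linarith
      · exact l2 j hj k hk h
      · have := bl j (.inr hj); have := br k (.inr hk); linarith
      · have := br j (.inr hj); linarith
      · have := br j (.inr hj); have := bl k (.inr hk); linarith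
      · exact r2 j hj k hk h
    · rintro j (hj | hj) k (rfl | hk | hk) h
      · have := bl j (.inl hj); linarith
      · exact l3 j hj k hk h
      · have := bl j (.inl hj); have := br k (.inr hk); linarith
      · have := br j (.inl hj); linarith
      · have := br j (.inl hj); have := bl k (.inr hk); linarith
      · exact r3 j hj k hk h

/-- The leaves of the subdivision of the circle given by a tree. -/
def circleLeaves (T : Shape) : Set (ℝ × ℝ) := leafParts T (1 / 6, 5 / 6)

/-- The intervals under the arcs of the subdivision of the circle given by a tree. -/
def circleCaps (T : Shape) : Set (ℝ × ℝ) :=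
  insert (-(1 / 6), 1 / 6) (midParts T (1 / 6, 5 / 6))

theorem exists_fst_mem_circleBlocks {T : Shape} {x : ℝ × ℝ} :
    (∃ b ∈ circleBlocks T, b.1 = x) ↔ x ∈ circleLeaves T := exists_fst_mem_blocks ..

theorem exists_snd_mem_circleBlocks {T : Shape} {x : ℝ × ℝ} :
    (∃ b ∈ circleBlocks T, b.2 = x) ↔ x ∈ circleCaps T := exists_snd_mem_blocks ..

theorem root_lt : ((1 / 6, 5 / 6) : ℝ × ℝ).1 < ((1 / 6, 5 / 6) : ℝ × ℝ).2 := by norm_num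

theorem circleLeaves_bounds {T : Shape} {x : ℝ × ℝ} (h : x ∈ circleLeaves T) :
    1 / 6 ≤ x.1 ∧ x.1 < x.2 ∧ x.2 ≤ 5 / 6 := bounds_of_mem_parts root_lt (.inl h)

theorem midParts_bounds {T : Shape} {x : ℝ × ℝ} (h : x ∈ midParts T (1 / 6, 5 / 6)) :
    1 / 6 ≤ x.1 ∧ x.1 < x.2 ∧ x.2 ≤ 5 / 6 := bounds_of_mem_parts root_lt (.inr h)

theorem eq_of_coe_eq {x y : ℝ} (h : (x : UnitAddCircle) = (y : UnitAddCircle))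
    (h1 : x - y < 1) (h2 : y - x < 1) : x = y := by
  obtain ⟨n, rfl⟩ := (coe_eq_coe_iff _ _).1 h
  have h3 : (n : ℝ) < 1 := by linarith
  have h4 : (-1 : ℝ) < n := by linarith
  have h3' : n < 1 := by exact_mod_cast h3
  have h4' : -1 < n := by exact_mod_cast h4
  obtain rfl : n = 0 := by omega
  simp

/-- All pieces but one lie in $[1/6,5/6]$. The exception starts at $-1/6\equiv5/6$, where no other
piece starts, so equality of starting points modulo $1$ is equality of real numbers. -/
theorem eq_of_coe_start_eq {T : Shape} {x y : ℝ × ℝ} (hx : x ∈ circleLeaves T ∪ circleCaps T)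
    (hy : y ∈ circleLeaves T ∪ circleCaps T)
    (h : (x.1 : UnitAddCircle) = (y.1 : UnitAddCircle)) :
    x = y ∧ ¬ (x ∈ circleLeaves T ∧ y ∈ circleCaps T) := by
  obtain ⟨h1, h2, h3⟩ := eq_of_start_eq (T := T) root_lt
  have aux : ∀ z : ℝ × ℝ, 1 / 6 ≤ z.1 ∧ z.1 < z.2 ∧ z.2 ≤ 5 / 6 →
      ((-(1 / 6) : ℝ) : UnitAddCircle) ≠ (z.1 : UnitAddCircle) := fun z hz h => by
    rw [coe_neg_one_sixth] at h
    have := eq_of_coe_eq h (by linarith) (by linarith)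
    linarith
  have key : ∀ z : ℝ × ℝ, z ∈ circleLeaves T ∪ circleCaps T → z = (-(1 / 6), 1 / 6) ∨
      1 / 6 ≤ z.1 ∧ z.1 < z.2 ∧ z.2 ≤ 5 / 6 := by
    rintro z (hz | rfl | hz)
    exacts [.inr (circleLeaves_bounds hz), .inl rfl, .inr (midParts_bounds hz)]
  rcases key x hx with rfl | bx <;> rcases key y hy with rfl | by'
  · refine ⟨rfl, fun h => ?_⟩
    have := circleLeaves_bounds h.1
    norm_num at this
  · exact (aux y by' h).elim
  · exact (aux x bx h.symm).elim
  · have h := eq_of_coe_eq h (by linarith) (by linarith)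
    have hx' : x ≠ (-(1 / 6), 1 / 6) := by rintro rfl; norm_num at bx
    have hy' : y ≠ (-(1 / 6), 1 / 6) := by rintro rfl; norm_num at by'
    rcases hx with hx | hx | hx <;> rcases hy with hy | hy | hy <;> try contradiction
    · refine ⟨h1 x hx y hy h, fun h' => ?_⟩
      rcases h'.2 with h' | h'
      exacts [hy' h', h3 x hx y h' h]
    · exact (h3 x hx y hy h).elim
    · exact (h3 y hy x hx h.symm).elim
    · exact ⟨h2 x hx y hy h, fun h' => h3 x h'.1 y hy h⟩

theorem notMem_circleCaps {T : Shape} {x : ℝ × ℝ} (hx : x ∈ circleLeaves T) :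
    x ∉ circleCaps T := fun h => (eq_of_coe_start_eq (.inl hx) (.inl hx) rfl).2 ⟨hx, h⟩

theorem isCapInterval_of_mem {T : Shape} {x : ℝ × ℝ} (h : x ∈ circleCaps T) :
    IsCapInterval x := by
  rcases h with rfl | h
  exacts [.inl rfl, .inr (IsGapInterval.root.mem_parts.2 x h)]

/-! ### Arc diagrams from trees -/

/-- The condition on `Z` says that none of its intervals is contained in `i`, so each removal by
`attach` deletes only the interval being subdivided. -/
theorem IsArcDiagram.attach_tree {A : Set (Sym2 UnitAddCircle)} {Z : Set (ℝ × ℝ)} {i : ℝ × ℝ}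
    (h : IsArcDiagram A (insert i Z)) (hi : i.1 < i.2)
    (hZ : ∀ z ∈ Z, i.1 ≤ z.1 → ¬ z.2 ≤ i.2) (T : Shape) :
    IsArcDiagram (A ∪ arcOver '' midParts T i) (Z ∪ (leafParts T i ∪ midParts T i)) := by
  induction T generalizing A Z i with
  | leaf => simpa [leafParts, midParts, Set.union_comm] using h
  | node l r hl hr =>
    have hiZ : i ∉ Z := fun hmem => hZ i hmem le_rfl le_rfl
    have h1 := h.attach i.1 i.2 (by simp)
    change IsArcDiagram (insert (arcOver (midPart i)) A)
      (insert i Z \ {i} ∪ {leftPart i, midPart i, rightPart i}) at h1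
    rw [Set.insert_sdiff_self_of_notMem hiZ] at h1
    have h2 := @hl _ (Z ∪ {midPart i, rightPart i}) (leftPart i)
      (by convert h1 using 1; ext; simp) (leftPart_lt hi) (by
        rintro z (hz | rfl | rfl) a b
        · exact hZ z hz a (b.trans (by simp only [leftPart]; linarith))
        · simp only [leftPart, midPart] at b; linarith
        · simp only [leftPart, rightPart] at b; linarith)
    have h3 := @hr _ (Z ∪ {midPart i} ∪ (leafParts l (leftPart i) ∪ midParts l (leftPart i)))
      (rightPart i) (by convert h2 using 1; ext; simp; tauto) (rightPart_lt hi) (by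
        rintro z ((hz | rfl) | hz) a b
        · exact hZ z hz (le_trans (by simp only [rightPart]; linarith) a) b
        · simp only [rightPart, midPart] at a; linarith
        · have := bounds_of_mem_parts (leftPart_lt hi) hz
          simp only [rightPart, leftPart] at a this; linarith)
    convert h3 using 1
    · rw [midParts, Set.image_insert_eq, Set.image_union, Set.union_insert, Set.insert_union,
        Set.insert_union, Set.union_assoc]
    · ext; simp [midParts, leafParts]; tauto

theorem isArcDiagram_of_shape {T : Shape} (hT : T.carets ≠ 0) :
    IsArcDiagram (arcOver '' circleCaps T) (circleLeaves T ∪ circleCaps T) := by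
  cases T with
  | leaf => exact (hT rfl).elim
  | node l r =>
    have h1 := @IsArcDiagram.attach_tree _ {(1 / 3, 2 / 3), (2 / 3, 5 / 6), (-(1 / 6), 1 / 6)}
      (1 / 6, 1 / 3) IsArcDiagram.base (by norm_num) (by
        rintro z (rfl | rfl | rfl) <;> norm_num) l
    have h2 := @IsArcDiagram.attach_tree _ ({(1 / 3, 2 / 3), (-(1 / 6), 1 / 6)} ∪
      (leafParts l (1 / 6, 1 / 3) ∪ midParts l (1 / 6, 1 / 3))) (2 / 3, 5 / 6)
      (by convert h1 using 1; ext; simp; tauto) (by norm_num) (by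
        rintro z ((rfl | rfl) | hz)
        · norm_num
        · norm_num
        · have := bounds_of_mem_parts (by norm_num) hz
          intro a; simp only at a this; linarith) r
    have hl : leftPart (1 / 6, 5 / 6) = (1 / 6, 1 / 3) := by norm_num [leftPart]
    have hr : rightPart (1 / 6, 5 / 6) = (2 / 3, 5 / 6) := by norm_num [rightPart]
    have hm : midPart (1 / 6, 5 / 6) = (1 / 3, 2 / 3) := by norm_num [midPart]
    have hc : s(((1 / 6 : ℝ) : UnitAddCircle), ((5 / 6 : ℝ) : UnitAddCircle)) =
        arcOver (-(1 / 6), 1 / 6) := by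
      rw [arcOver, coe_neg_one_sixth, Sym2.eq_swap]
    rw [hc] at h2
    convert h2 using 1
    · rw [circleCaps, midParts, hl, hr, hm, Set.image_insert_eq, Set.image_insert_eq,
        Set.image_union, Set.insert_comm, Set.insert_union, Set.singleton_union, Set.insert_union,
        Set.insert_union]
      rfl
    · rw [circleLeaves, circleCaps, midParts, leafParts, hl, hr, hm]
      ext; simp; tauto

theorem exists_attach {T : Shape} {i j : ℝ × ℝ} (hi : i.1 < i.2) (hj : j ∈ leafParts T i) :
    ∃ T' : Shape, T'.carets = T.carets + 1 ∧ midParts T' i = insert (midPart j) (midParts T i) ∧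
      leafParts T' i = leafParts T i \ {j} ∪ {leftPart j, rightPart j} := by
  induction T generalizing i with
  | leaf =>
    obtain rfl : j = i := hj
    exact ⟨node leaf leaf, rfl, by simp [midParts], by simp [leafParts, Set.pair_comm]⟩
  | node l r hl hr =>
    rcases hj with hj | hj
    · obtain ⟨T', h1, h2, h3⟩ := hl (leftPart_lt hi) hj
      have hn : j ∉ leafParts r (rightPart i) := fun hj' => by
        have h1 := bounds_of_mem_parts (leftPart_lt hi) (.inl hj)
        have h2 := bounds_of_mem_parts (rightPart_lt hi) (.inl hj')
        simp only [leftPart, rightPart] at h1 h2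
        linarith
      refine ⟨node T' r, by simp only [carets]; omega, ?_, ?_⟩
      · rw [midParts, h2, midParts]; ext; simp; tauto
      · rw [leafParts, h3, leafParts, Set.union_sdiff_distrib, Set.sdiff_singleton_eq_self hn]
        ext; simp; tauto
    · obtain ⟨T', h1, h2, h3⟩ := hr (rightPart_lt hi) hj
      have hn : j ∉ leafParts l (leftPart i) := fun hj' => by
        have h1 := bounds_of_mem_parts (leftPart_lt hi) (.inl hj')
        have h2 := bounds_of_mem_parts (rightPart_lt hi) (.inl hj)
        simp only [leftPart, rightPart] at h1 h2
        linarith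
      refine ⟨node l T', by simp only [carets]; omega, ?_, ?_⟩
      · rw [midParts, h2, midParts]; ext; simp; tauto
      · rw [leafParts, h3, leafParts, Set.union_sdiff_distrib, Set.sdiff_singleton_eq_self hn,
          Set.union_assoc]

theorem IsArcDiagram.exists_shape {A : Set (Sym2 UnitAddCircle)} {I : Set (ℝ × ℝ)}
    (h : IsArcDiagram A I) (hA : ∀ e ∈ A, IsCentralArc e) :
    ∃ T : Shape, T.carets ≠ 0 ∧ A = arcOver '' circleCaps T ∧
      I = circleLeaves T ∪ circleCaps T := by
  induction h with
  | base =>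
    have hl : leftPart (1 / 6, 5 / 6) = (1 / 6, 1 / 3) := by norm_num [leftPart]
    have hr : rightPart (1 / 6, 5 / 6) = (2 / 3, 5 / 6) := by norm_num [rightPart]
    have hm : midPart (1 / 6, 5 / 6) = (1 / 3, 2 / 3) := by norm_num [midPart]
    have hc : s(((1 / 6 : ℝ) : UnitAddCircle), ((5 / 6 : ℝ) : UnitAddCircle)) =
        arcOver (-(1 / 6), 1 / 6) := by
      rw [arcOver, coe_neg_one_sixth, Sym2.eq_swap]
    refine ⟨node leaf leaf, by simp [carets], ?_, ?_⟩
    · rw [hc, circleCaps, midParts, hm, Set.image_insert_eq, Set.image_insert_eq]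
      ext; simp [arcOver, midParts]; tauto
    · rw [circleLeaves, circleCaps, midParts, leafParts, hl, hr, hm]
      ext; simp [midParts, leafParts]; tauto
  | attach h a b hab ih =>
    obtain ⟨T, hT, rfl, rfl⟩ := ih fun e he => hA e (.inr he)
    rcases hab with hab | hab
    · have hn := notMem_circleCaps hab
      obtain ⟨T', h1, h2, h3⟩ := exists_attach root_lt hab
      refine ⟨T', by omega, ?_, ?_⟩
      · rw [circleCaps, circleCaps, h2, Set.insert_comm,
          Set.image_insert_eq (a := midPart (a, b))]
        rfl
      · rw [Set.union_sdiff_distrib, Set.sdiff_singleton_eq_self hn, circleLeaves, circleLeaves, h3,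
          circleCaps, circleCaps, h2]
        ext; simp [leftPart, rightPart, midPart]; tauto
    -- A primary arc attached under a central arc has both ends strictly under it, so it is not
    -- central.
    · have hc := isCapInterval_of_mem hab
      have hw := hc.width
      simp only at hw
      exact (hc.not_isCentralArc (by simp only; linarith) (by linarith) (by simp only; linarith)
        (hA _ (.inl rfl))).elim

/-! ### From pairs of trees to arc pair diagrams -/

theorem map_arcOver {f : UnitAddCircle ≃ₜ UnitAddCircle} {i j : ℝ × ℝ} (h : MapsLinearly f i j) :
    Sym2.map f (arcOver i) = arcOver j := by
  rw [arcOver, Sym2.map_mk, h.start, h.finish]; rfl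

theorem exists_of_forall₂_symm {α β : Type*} {R : α → β → Prop} {l : List α} {m : List β}
    (h : List.Forall₂ R l m) {b : β} (hb : b ∈ m) : ∃ a ∈ l, R a b := by
  obtain ⟨a, ha, h, -⟩ := exists_of_forall₂ h.flip h.flip hb
  exact ⟨a, ha, h⟩

theorem IsTreeMap.mem_rist {f : UnitAddCircle ≃ₜ UnitAddCircle} (hf : IsTreeMap f) :
    f ∈ rist := by
  obtain ⟨S, T, l, hS, hl, h⟩ := hf
  have hT : T.carets ≠ 0 := carets_eq hl h ▸ hS
  have hblock : ∀ b ∈ circleBlocks S, ∃ c ∈ circleBlocks T, MapsBlock f b c := fun b hb => by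
    obtain ⟨c, hc, hbc, -⟩ := exists_of_forall₂ h h hb
    exact ⟨c, hl.mem_iff.1 hc, hbc⟩
  have hblock' : ∀ c ∈ circleBlocks T, ∃ b ∈ circleBlocks S, MapsBlock f b c := fun c hc =>
    exists_of_forall₂_symm h (hl.mem_iff.2 hc)
  have hcap : ∀ x ∈ circleCaps S, ∃ y ∈ circleCaps T, MapsLinearly f x y := fun x hx => by
    obtain ⟨b, hb, rfl⟩ := exists_snd_mem_circleBlocks.2 hx
    obtain ⟨c, hc, hbc⟩ := hblock b hb
    exact ⟨c.2, exists_snd_mem_circleBlocks.1 ⟨c, hc, rfl⟩, hbc.2⟩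
  have hcap' : ∀ y ∈ circleCaps T, ∃ x ∈ circleCaps S, MapsLinearly f x y := fun x hx => by
    obtain ⟨c, hc, rfl⟩ := exists_snd_mem_circleBlocks.2 hx
    obtain ⟨b, hb, hbc⟩ := hblock' c hc
    exact ⟨b.2, exists_snd_mem_circleBlocks.1 ⟨b, hb, rfl⟩, hbc.2⟩
  have hpiece : ∀ x : ↥(circleLeaves S ∪ circleCaps S), ∃ y : ↥(circleLeaves T ∪ circleCaps T),
      MapsLinearly f x y := by
    rintro ⟨x, hx | hx⟩
    · obtain ⟨b, hb, rfl⟩ := exists_fst_mem_circleBlocks.2 hx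
      obtain ⟨c, hc, hbc⟩ := hblock b hb
      exact ⟨⟨c.1, .inl (exists_fst_mem_circleBlocks.1 ⟨c, hc, rfl⟩)⟩, hbc.1⟩
    · obtain ⟨y, hy, hxy⟩ := hcap x hx
      exact ⟨⟨y, .inr hy⟩, hxy⟩
  have hpiece' : ∀ y : ↥(circleLeaves T ∪ circleCaps T), ∃ x : ↥(circleLeaves S ∪ circleCaps S),
      MapsLinearly f x y := by
    rintro ⟨y, hy | hy⟩
    · obtain ⟨c, hc, rfl⟩ := exists_fst_mem_circleBlocks.2 hy
      obtain ⟨b, hb, hbc⟩ := hblock' c hc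
      exact ⟨⟨b.1, .inl (exists_fst_mem_circleBlocks.1 ⟨b, hb, rfl⟩)⟩, hbc.1⟩
    · obtain ⟨x, hx, hxy⟩ := hcap' y hy
      exact ⟨⟨x, .inr hx⟩, hxy⟩
  choose φ hφ using hpiece
  have hbij : Function.Bijective φ := by
    constructor
    · intro x y hxy
      have h1 := (hφ x).start
      rw [hxy, ← (hφ y).start] at h1
      exact Subtype.ext (eq_of_coe_start_eq x.2 y.2 (f.injective h1)).1
    · intro y
      obtain ⟨x, hx⟩ := hpiece' y
      have h1 := (hφ x).start
      rw [hx.start] at h1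
      exact ⟨x, Subtype.ext (eq_of_coe_start_eq y.2 (φ x).2 h1).1.symm⟩
  have harc : ∀ e, e ∈ arcOver '' circleCaps S ↔ Sym2.map f e ∈ arcOver '' circleCaps T := by
    intro e
    constructor
    · rintro ⟨x, hx, rfl⟩
      obtain ⟨y, hy, hxy⟩ := hcap x hx
      exact ⟨y, hy, (map_arcOver hxy).symm⟩
    · rintro ⟨y, hy, he⟩
      obtain ⟨x, hx, hxy⟩ := hcap' y hy
      rw [← map_arcOver hxy] at he
      exact ⟨x, hx, Sym2.map.injective f.injective he⟩
  let P : ArcPairDiagram :=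
    { domain := ⟨_, _, isArcDiagram_of_shape hS⟩
      range := ⟨_, _, isArcDiagram_of_shape hT⟩
      toEquiv := Equiv.ofBijective φ hbij
      succ_iff := fun i j => by
        change ((i.1.2 : ℝ) : UnitAddCircle) = (j.1.1 : ℝ) ↔
          (((φ i).1.2 : ℝ) : UnitAddCircle) = ((φ j).1.1 : ℝ)
        rw [← (hφ i).finish, ← (hφ j).start, f.injective.eq_iff]
      arc_iff := fun i j => by
        change s(((i.1.1 : ℝ) : UnitAddCircle), ((j.1.1 : ℝ) : UnitAddCircle)) ∈
            arcOver '' circleCaps S ↔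
          s((((φ i).1.1 : ℝ) : UnitAddCircle), (((φ j).1.1 : ℝ) : UnitAddCircle)) ∈
            arcOver '' circleCaps T
        rw [harc, Sym2.map_mk, (hφ i).start, (hφ j).start] }
  have hP : P.Defines f := fun i => hφ i
  refine ⟨⟨P, hP⟩, P, hP, ?_, ?_⟩
  · rintro _ ⟨x, hx, rfl⟩
    exact (isCapInterval_of_mem hx).isCentralArc
  · rintro _ ⟨x, hx, rfl⟩
    exact (isCapInterval_of_mem hx).isCentralArc

/-! ### From arc pair diagrams to pairs of trees -/

theorem blocks_linked {T : Shape} {i u : ℝ × ℝ} (h : (i.2 : UnitAddCircle) = (u.1 : UnitAddCircle)) :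
    ∀ b ∈ blocks T i u, (b.1.2 : UnitAddCircle) = (b.2.1 : UnitAddCircle) := by
  induction T generalizing i u with
  | leaf => simpa [blocks] using h
  | node l r hl hr =>
    intro b hb
    rcases List.mem_append.1 hb with hb | hb
    exacts [hl rfl b hb, hr (i := rightPart i) h b hb]

theorem head_blocks (T : Shape) (i u : ℝ × ℝ) :
    ∀ b ∈ (blocks T i u).head?, b.1.1 = i.1 := by
  induction T generalizing i u with
  | leaf => simp [blocks]
  | node l r hl hr =>
    intro b hb
    have hne : blocks l (leftPart i) (midPart i) ≠ [] := by
      rw [← List.length_pos_iff, length_blocks]; omega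
    rw [blocks, List.head?_append_of_ne_nil _ hne] at hb
    exact hl (leftPart i) (midPart i) b hb

theorem getLast_blocks (T : Shape) (i u : ℝ × ℝ) :
    ∀ b ∈ (blocks T i u).getLast?, b.2 = u := by
  induction T generalizing i u with
  | leaf => simp [blocks]
  | node l r hl hr =>
    intro b hb
    have hne : blocks r (rightPart i) u ≠ [] := by
      rw [← List.length_pos_iff, length_blocks]; omega
    rw [blocks, List.getLast?_append_of_ne_nil _ hne] at hb
    exact hr (rightPart i) u b hb

theorem isChain_blocks (T : Shape) (i u : ℝ × ℝ) :
    (blocks T i u).IsChain fun b c => b.2.2 = c.1.1 := by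
  induction T generalizing i u with
  | leaf => simp [blocks]
  | node l r hl hr =>
    refine List.isChain_append.2 ⟨hl _ _, hr _ _, fun b hb c hc => ?_⟩
    rw [getLast_blocks _ _ _ b hb, head_blocks _ _ _ c hc]
    rfl

theorem nodup_fst_blocks {T : Shape} {i u : ℝ × ℝ} (hi : i.1 < i.2) :
    ((blocks T i u).map Prod.fst).Nodup := by
  induction T generalizing i u with
  | leaf => simp [blocks]
  | node l r hl hr =>
    rw [blocks, List.map_append]
    refine List.Nodup.append (hl (leftPart_lt hi)) (hr (rightPart_lt hi)) fun x hx hy => ?_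
    have h1 := bounds_of_mem_parts (leftPart_lt hi)
      (.inl ((exists_fst_mem_blocks ..).1 (List.mem_map.1 hx)))
    have h2 := bounds_of_mem_parts (rightPart_lt hi)
      (.inl ((exists_fst_mem_blocks ..).1 (List.mem_map.1 hy)))
    simp only [leftPart, rightPart] at h1 h2
    linarith

theorem index_eq_of_coe_eq {T : Shape} {j k : ℕ} (hj : j < (circleBlocks T).length)
    (hk : k < (circleBlocks T).length) (h : ((circleBlocks T)[j].1.1 : UnitAddCircle) =
      ((circleBlocks T)[k].1.1 : UnitAddCircle)) : j = k := by
  have h1 := (eq_of_coe_start_eq (T := T)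
    (.inl (exists_fst_mem_circleBlocks.1 ⟨_, List.getElem_mem hj, rfl⟩))
    (.inl (exists_fst_mem_circleBlocks.1 ⟨_, List.getElem_mem hk, rfl⟩)) h).1
  refine ((nodup_fst_blocks (T := T) (u := (-(1 / 6), 1 / 6)) root_lt).getElem_inj_iff
    (hi := by rwa [List.length_map]) (hj := by rwa [List.length_map])).1 ?_
  rw [List.getElem_map, List.getElem_map]
  exact h1

theorem circleBlocks_succ {T : Shape} {j k : ℕ} (hj : j < (circleBlocks T).length)
    (hk : k < (circleBlocks T).length) (h : k = (j + 1) % (circleBlocks T).length) :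
    ((circleBlocks T)[j].2.2 : UnitAddCircle) = ((circleBlocks T)[k].1.1 : UnitAddCircle) := by
  rcases (Nat.succ_le_of_lt hj).lt_or_eq with h' | h'
  · obtain rfl : k = j + 1 := by rw [h]; exact Nat.mod_eq_of_lt h'
    exact congrArg _ (List.isChain_iff_getElem.1 (isChain_blocks T _ _) j hk)
  · obtain rfl : k = 0 := by rw [h, ← h']; exact Nat.mod_self _
    have h1 : (circleBlocks T)[j].2 = (-(1 / 6), 1 / 6) := by
      refine getLast_blocks T (1 / 6, 5 / 6) _ _ ?_
      rw [List.getLast?_eq_getElem?]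
      change (circleBlocks T)[(circleBlocks T).length - 1]? = _
      rw [← h']
      simp
    have h2 : (circleBlocks T)[0].1.1 = 1 / 6 := by
      refine head_blocks T (1 / 6, 5 / 6) (-(1 / 6), 1 / 6) _ ?_
      rw [List.head?_eq_getElem?]
      exact List.getElem?_eq_getElem hk
    rw [h1, h2]

theorem isTreeMap_of_mapsBlock {f : UnitAddCircle ≃ₜ UnitAddCircle} {S T : Shape}
    (hS : S.carets ≠ 0) (h : ∀ b ∈ circleBlocks S, ∃ c ∈ circleBlocks T, MapsBlock f b c)
    (h' : ∀ c ∈ circleBlocks T, ∃ b ∈ circleBlocks S, MapsBlock f b c) : IsTreeMap f := by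
  have hex : ∀ j : Fin (circleBlocks S).length, ∃ k : Fin (circleBlocks T).length,
      MapsBlock f (circleBlocks S)[j] (circleBlocks T)[k] := fun j => by
    obtain ⟨c, hc, hbc⟩ := h _ (List.getElem_mem j.2)
    obtain ⟨k, hk, rfl⟩ := List.getElem_of_mem hc
    exact ⟨⟨k, hk⟩, hbc⟩
  choose φ hφ using hex
  have hbij : Function.Bijective φ := by
    constructor
    · intro j k hjk
      have h1 := (hφ j).1.start
      rw [hjk, ← (hφ k).1.start] at h1
      exact Fin.ext (index_eq_of_coe_eq _ _ (f.injective h1))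
    · intro k
      obtain ⟨b, hb, hbc⟩ := h' _ (List.getElem_mem k.2)
      obtain ⟨j, hj, rfl⟩ := List.getElem_of_mem hb
      refine ⟨⟨j, hj⟩, Fin.ext (index_eq_of_coe_eq (T := T) (Fin.is_lt _) k.2 ?_)⟩
      have h1 := (hφ ⟨j, hj⟩).1.start
      have h2 := hbc.1.start
      exact h1.symm.trans h2
  have hlen : (circleBlocks S).length = (circleBlocks T).length := by
    simpa using Fintype.card_of_bijective hbij
  have hpos : 0 < (circleBlocks S).length := by rw [length_circleBlocks]; omega
  -- The end of one block is the start of the next, and `f` respects this, so the index map advances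
  -- by one modulo the length: it is a rotation.
  have hind : ∀ (j : ℕ) (hj : j < (circleBlocks S).length),
      (φ ⟨j, hj⟩ : ℕ) = (j + φ ⟨0, hpos⟩) % (circleBlocks T).length := by
    intro j
    induction j with
    | zero => intro hj; rw [zero_add, Nat.mod_eq_of_lt (φ ⟨0, hpos⟩).2]
    | succ j ih =>
      intro hj
      have hj' : j < (circleBlocks S).length := by omega
      have hlt : (j + 1 + φ ⟨0, hpos⟩) % (circleBlocks T).length < (circleBlocks T).length :=
        Nat.mod_lt _ (by omega)
      refine index_eq_of_coe_eq (φ ⟨j + 1, hj⟩).2 hlt ?_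
      have h1 := (hφ ⟨j + 1, hj⟩).1.start
      have h2 := (hφ ⟨j, hj'⟩).2.finish
      have h3 := circleBlocks_succ (T := S) hj' hj (Nat.mod_eq_of_lt hj).symm
      have h4 := circleBlocks_succ (T := T) (φ ⟨j, hj'⟩).2 hlt (by
        rw [ih hj', Nat.mod_add_mod]; congr 1; ring)
      refine Eq.trans h1.symm (Eq.trans ?_ h4)
      refine Eq.trans ?_ h2
      exact congrArg f h3.symm
  refine ⟨S, T, (circleBlocks T).rotate (φ ⟨0, hpos⟩), hS, .symm ⟨_, rfl⟩,
    List.forall₂_iff_get.2 ⟨by rw [List.length_rotate, hlen], fun j hj hj' => ?_⟩⟩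
  have h1 := hφ ⟨j, hj⟩
  simp only [List.get_eq_getElem, List.getElem_rotate]
  simp only [Fin.getElem_fin, hind j hj] at h1
  exact h1

/-- The tree must be nontrivial: otherwise the single leaf $[1/6,5/6]$ would have the same endpoints
as the arc $\{5/6,1/6\}$. -/
theorem mem_circleCaps_of_arcOver_mem {T : Shape} (hT : T.carets ≠ 0) {x : ℝ × ℝ}
    (hx : x ∈ circleLeaves T ∪ circleCaps T) (h : arcOver x ∈ arcOver '' circleCaps T) :
    x ∈ circleCaps T := by
  rcases hx with hx | hx
  swap; · exact hx
  obtain ⟨v, hv, hvx⟩ := h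
  rcases Sym2.eq_iff.1 hvx with ⟨h1, -⟩ | ⟨h1, h2⟩
  · rwa [(eq_of_coe_start_eq (.inl hx) (.inr hv) h1.symm).1]
  · obtain ⟨b1, b2, b3⟩ := circleLeaves_bounds hx
    rcases hv with rfl | hv
    · rw [coe_neg_one_sixth] at h1
      have e1 := eq_of_coe_eq h1 (by linarith) (by linarith)
      have e2 := eq_of_coe_eq h2 (by simp only; linarith) (by simp only; linarith)
      simp only at e2
      cases T with
      | leaf => exact (hT rfl).elim
      | node l r =>
        rcases hx with hx | hx
        · have := bounds_of_mem_parts (leftPart_lt root_lt) (.inl hx)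
          simp only [leftPart] at this
          linarith
        · have := bounds_of_mem_parts (rightPart_lt root_lt) (.inl hx)
          simp only [rightPart] at this
          linarith
    · obtain ⟨c1, c2, c3⟩ := midParts_bounds hv
      have e1 := eq_of_coe_eq h1 (by linarith) (by linarith)
      have e2 := eq_of_coe_eq h2 (by linarith) (by linarith)
      linarith

theorem exists_next {T : Shape} {x : ℝ × ℝ} (hx : x ∈ circleCaps T) :
    ∃ y ∈ circleLeaves T, (x.2 : UnitAddCircle) = (y.1 : UnitAddCircle) := by
  obtain ⟨b, hb, rfl⟩ := exists_snd_mem_circleBlocks.2 hx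
  obtain ⟨j, hj, rfl⟩ := List.getElem_of_mem hb
  have hlt : (j + 1) % (circleBlocks T).length < (circleBlocks T).length :=
    Nat.mod_lt _ (by omega)
  exact ⟨_, exists_fst_mem_circleBlocks.1 ⟨_, List.getElem_mem hlt, rfl⟩,
    circleBlocks_succ hj hlt rfl⟩

theorem mapsBlock_of_mapsLinearly {f : UnitAddCircle ≃ₜ UnitAddCircle} {S T : Shape}
    (hleaf : ∀ x ∈ circleLeaves S, ∃ y ∈ circleLeaves T, MapsLinearly f x y)
    (hcap : ∀ x ∈ circleCaps S, ∃ y ∈ circleCaps T, MapsLinearly f x y) :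
    ∀ b ∈ circleBlocks S, ∃ c ∈ circleBlocks T, MapsBlock f b c := by
  intro b hb
  obtain ⟨y, hy, h1⟩ := hleaf b.1 (exists_fst_mem_circleBlocks.1 ⟨b, hb, rfl⟩)
  obtain ⟨z, hz, h2⟩ := hcap b.2 (exists_snd_mem_circleBlocks.1 ⟨b, hb, rfl⟩)
  obtain ⟨c, hc, rfl⟩ := exists_fst_mem_circleBlocks.2 hy
  have e1 := blocks_linked (T := S) coe_neg_one_sixth.symm b hb
  have e2 := blocks_linked (T := T) coe_neg_one_sixth.symm c hc
  have e3 : (z.1 : UnitAddCircle) = (c.2.1 : UnitAddCircle) := by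
    rw [← h2.start, ← e1, h1.finish, e2]
  obtain rfl := (eq_of_coe_start_eq (.inr hz)
    (.inr (exists_snd_mem_circleBlocks.1 ⟨c, hc, rfl⟩)) e3).1
  exact ⟨c, hc, h1, h2⟩

theorem isTreeMap_of_mem_rist {f : UnitAddCircle ≃ₜ UnitAddCircle} (hf : f ∈ rist) :
    IsTreeMap f := by
  obtain ⟨-, ⟨⟨A, I, hD⟩, ⟨A', I', hR⟩, σ, hsucc, harc⟩, hP, hA, hA'⟩ := hf
  obtain ⟨S, hS, rfl, rfl⟩ := hD.exists_shape hA
  obtain ⟨T, hT, rfl, rfl⟩ := hR.exists_shape hA'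
  change ↥(circleLeaves S ∪ circleCaps S) ≃ ↥(circleLeaves T ∪ circleCaps T) at σ
  replace hP : ∀ x : ↥(circleLeaves S ∪ circleCaps S), MapsLinearly f x (σ x) := hP
  -- A piece lies under an arc exactly when its two ends are joined by one. The far end of such a
  -- piece is the start of the next leaf, so `arc_iff` applies to these two starting points.
  have hiff : ∀ x : ↥(circleLeaves S ∪ circleCaps S),
      x.1 ∈ circleCaps S ↔ (σ x).1 ∈ circleCaps T := by
    intro x
    constructor
    · intro hx
      obtain ⟨y, hy, hxy⟩ := exists_next hx
      have h1 := (harc x ⟨y, .inl hy⟩).1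
      change s((x.1.1 : UnitAddCircle), (y.1 : UnitAddCircle)) ∈ arcOver '' circleCaps S →
        s(((σ x).1.1 : UnitAddCircle), ((σ ⟨y, .inl hy⟩).1.1 : UnitAddCircle)) ∈
          arcOver '' circleCaps T at h1
      rw [← (hP ⟨y, .inl hy⟩).start, ← hxy, (hP x).finish] at h1
      exact mem_circleCaps_of_arcOver_mem hT (σ x).2 (h1 ⟨x, hx, rfl⟩)
    · intro hx
      obtain ⟨y, hy, hxy⟩ := exists_next hx
      obtain ⟨z, hz⟩ := σ.surjective ⟨y, .inl hy⟩
      have h1 := (harc x z).2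
      change s(((σ x).1.1 : UnitAddCircle), ((σ z).1.1 : UnitAddCircle)) ∈
          arcOver '' circleCaps T →
        s((x.1.1 : UnitAddCircle), (z.1.1 : UnitAddCircle)) ∈ arcOver '' circleCaps S at h1
      have h2 := (hP z).start
      rw [hz, ← hxy, ← (hP x).finish] at h2
      rw [hz, ← hxy, f.injective h2] at h1
      exact mem_circleCaps_of_arcOver_mem hS x.2 (h1 ⟨_, hx, rfl⟩)
  have hiff' : ∀ x : ↥(circleLeaves S ∪ circleCaps S),
      x.1 ∈ circleLeaves S ↔ (σ x).1 ∈ circleLeaves T := by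
    intro x
    have h1 := x.2
    have h2 := (σ x).2
    have h3 := hiff x
    have h4 := @notMem_circleCaps S x.1
    have h5 := @notMem_circleCaps T (σ x).1
    simp only [Set.mem_union] at h1 h2
    tauto
  have hsymm : ∀ y : ↥(circleLeaves T ∪ circleCaps T), MapsLinearly f⁻¹ y (σ.symm y) := fun y => by
    simpa using (hP (σ.symm y)).symm
  refine isTreeMap_of_mapsBlock (T := T) hS (mapsBlock_of_mapsLinearly ?_ ?_) fun c hc => ?_
  · exact fun x hx => ⟨_, (hiff' ⟨x, .inl hx⟩).1 hx, hP ⟨x, .inl hx⟩⟩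
  · exact fun x hx => ⟨_, (hiff ⟨x, .inr hx⟩).1 hx, hP ⟨x, .inr hx⟩⟩
  · obtain ⟨b, hb, h⟩ := mapsBlock_of_mapsLinearly (f := f⁻¹) (S := T) (T := S)
      (fun y hy => ⟨_, (hiff' (σ.symm ⟨y, .inl hy⟩)).2 (by simpa using hy), hsymm ⟨y, .inl hy⟩⟩)
      (fun y hy => ⟨_, (hiff (σ.symm ⟨y, .inr hy⟩)).2 (by simpa using hy), hsymm ⟨y, .inr hy⟩⟩) c hc
    exact ⟨b, hb, by simpa using h.1.symm, by simpa using h.2.symm⟩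

end Basilica

theorem mainTheorem7 :
    (Subgroup.closure {Basilica.beta, Basilica.gamma, Basilica.delta} :
      Set (UnitAddCircle ≃ₜ UnitAddCircle)) = Basilica.rist := by
  rw [Basilica.closure_eq_treeMaps]
  exact Set.Subset.antisymm (fun _ => Basilica.IsTreeMap.mem_rist)
    fun _ => Basilica.isTreeMap_of_mem_rist
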